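/- For $s,t\in\mathbb R$ let $a(t)=\begin{pmatrix}e^{t/2}&0\\0&e^{-t/2}\end{pmatrix}$, $u(s)=\begin{pmatrix}1&s\\0&1\end{pmatrix}$, and let $B<\mathrm{SL}_2(\mathbb R)$ be the subgroup they generate. Let $X$ be a locally compact, second countable Hausdorff space with a continuous action of $B$, and let $\mu$ be a Borel probability measure on $X$ that is invariant and ergodic under the flow $(a(t))_{t\in\mathbb R}$ and is $u$-free, i.e. for $\mu$-almost every $x$ the only $s\in\mathbb R$ with $u(s)x=x$ is $s=0$. For a nonnegative measurable $f:\mathbb R\to\mathbb R$ with $\int_{\mathbb R} f(s)\,ds=1$ put $S_f\mu=\int_{\mathbb R}f(s)\,u(-s)_*\mu\,ds$. A system of $u$-leafwise measures for $\mu$ is a measurable map $y\mapsto\mu^u_y$ from $X$ to the locally finite Borel measures on $\mathbb R$ such that (i) for all $s\in\mathbb R$ and $y\in X$, $\mu^u_{u(s)y}$ is a positive finite multiple of the image of $\mu^u_y$ under $r\mapsto r-s$; (ii) for every $f$ as above, $0<\int f\,d\mu^u_y<\infty$ for $S_f\mu$-almost every $y$, and for every measurable $g:X\times\mathbb R\to[0,\infty]$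 $$\int_{\mathbb R}\int_X f(s)\,g(u(-s)x,s)\,d\mu(x)\,ds=\int_X\frac{\int_{\mathbb R}g(y,s)f(s)\,d\mu^u_y(s)}{\int_{\mathbb R}f\,d\mu^u_y}\,dS_f\mu(y).$$ Write $\dim^u(\mu)=\delta$ if such a system exists and, for every such system and $\mu$-almost every $x$, $\mu_x^u([-e^{-t},e^{-t}])>0$ for all $t$ and $\lim_{t\to\infty}\frac1t\log\mu^u_x([-e^{-t},e^{-t}])=-\delta$. Then $\dim^u(\mu)$ exists as a real number, and there is a measurable function $p:X\to[0,1]$ such that, with $H(p,1-p)=-p\log p-(1-p)\log(1-p)$ (where $0\log 0=0$), $$\int_X H(p(x),1-p(x))\,dS_{1_{[0,1)}}\mu(x)=\dim^u(\mu)\log 2$$ and $$\int_X\omega_x\,dS_{1_{[0,1)}}\mu(x)=S_{1_{[0,1)}}\mu,\qquad \omega_x=p(x)\,\delta_{a(\log 2)x}+(1-p(x))\,\delta_{u(1)a(\log 2)x}.$$ -/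

import Mathlib

open MeasureTheory Filter Topology Set
open scoped NNReal ENNReal MatrixGroups

noncomputable section

/-- The diagonal matrix `a(t) = diag(e^{t/2}, e^{-t/2})` in `SL(2, ℝ)`. -/
def aMat (t : ℝ) : SL(2, ℝ) :=
  ⟨!![Real.exp (t / 2), 0; 0, Real.exp (-t / 2)], by
    rw [Matrix.det_fin_two_of, ← Real.exp_add]; ring_nf; simp⟩

/-- The unipotent matrix `u(s) = [1, s; 0, 1]` in `SL(2, ℝ)`. -/
def uMat (s : ℝ) : SL(2, ℝ) :=
  ⟨!![1, s; 0, 1], by simp [Matrix.det_fin_two_of]⟩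

/-- The group `B`, the subgroup of `SL(2, ℝ)` generated by all `a(t)` and `u(s)`. It carries the
subspace topology from `SL(2, ℝ)`. -/
def BGroup : Subgroup SL(2, ℝ) :=
  Subgroup.closure (Set.range aMat ∪ Set.range uMat)

/-- `a(t)` as an element of `B`. -/
def aB (t : ℝ) : BGroup := ⟨aMat t, Subgroup.subset_closure (Or.inl ⟨t, rfl⟩)⟩

/-- `u(s)` as an element of `B`. -/
def uB (s : ℝ) : BGroup := ⟨uMat s, Subgroup.subset_closure (Or.inr ⟨s, rfl⟩)⟩

theorem aB_zero : aB 0 = 1 := by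
  apply Subtype.ext; apply Subtype.ext
  ext i j; fin_cases i <;> fin_cases j <;> simp [aB, aMat]

theorem aB_add (s t : ℝ) : aB (s + t) = aB s * aB t := by
  have h1 : (s + t) / 2 = s / 2 + t / 2 := by ring
  have h2 : (-t + -s) / 2 = -s / 2 + -t / 2 := by ring
  apply Subtype.ext
  change aMat (s + t) = aMat s * aMat t
  apply Subtype.ext
  rw [Matrix.SpecialLinearGroup.coe_mul]
  simp [aMat, h1, h2, Real.exp_add]

/-- The one-parameter subgroup `{a(t) : t ∈ ℝ}` of `B`. -/
def aSubgroup : Subgroup BGroup where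
  carrier := Set.range aB
  one_mem' := ⟨0, aB_zero⟩
  mul_mem' := by
    rintro _ _ ⟨s, rfl⟩ ⟨t, rfl⟩
    exact ⟨s + t, aB_add s t⟩
  inv_mem' := by
    rintro _ ⟨t, rfl⟩
    refine ⟨-t, ?_⟩
    rw [eq_inv_iff_mul_eq_one, ← aB_add, neg_add_cancel, aB_zero]

section Leafwise

variable {X : Type*} [MulAction BGroup X] [MeasurableSpace X]

/-- `μ` is `u`-free: almost every point has trivial stabilizer under `s ↦ u(s)`. -/
def IsUFree (μ : Measure X) : Prop :=
  ∀ᵐ x ∂μ, ∀ s : ℝ, uB s • x = x → s = 0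

/-- The anti-convolution `S_f μ = ∫ f(s) (u(-s)_* μ) ds`. -/
def antiConv (f : ℝ → ℝ≥0) (μ : Measure X) : Measure X :=
  ((volume : Measure ℝ).withDensity fun s => (f s : ℝ≥0∞)).bind
    fun s => μ.map fun x => uB (-s) • x

/-- Proportionality of measures: equality up to a constant in `(0, ∞)`. -/
def MeasProp (ν₁ ν₂ : Measure ℝ) : Prop :=
  ∃ c : ℝ≥0, c ≠ 0 ∧ ν₁ = c • ν₂

/-- The image `ω` of `μ × Lebesgue` under `F(x, s) = (u(-s) x, s)`. -/
def shearMeasure (μ : Measure X) : Measure (X × ℝ) :=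
  (μ.prod (volume : Measure ℝ)).map fun q => (uB (-q.2) • q.1, q.2)

/-- `σ` is a system of `u`-leafwise measures `y ↦ μ_y^u` for `μ`. The last field is the identity
`f̃ · ω = ∫ δ_y × (f · μ_y^u) / μ_y^u(f) d(S_f μ)(y)` of measures on `X × ℝ`, evaluated on an
arbitrary nonnegative measurable function `g`. -/
structure IsLeafwiseSystem (μ : Measure X) (σ : X → Measure ℝ) : Prop where
  measurable : Measurable σ
  locallyFinite : ∀ y, IsLocallyFiniteMeasure (σ y)
  equivariant : ∀ (s : ℝ) (y : X), MeasProp (σ (uB s • y)) ((σ y).map fun r => r - s)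
  mass : ∀ f : ℝ → ℝ≥0, Measurable f → ∫⁻ s, f s = 1 →
    ∀ᵐ y ∂(antiConv f μ), 0 < ∫⁻ s, f s ∂(σ y) ∧ ∫⁻ s, f s ∂(σ y) < ∞
  disintegration : ∀ f : ℝ → ℝ≥0, Measurable f → ∫⁻ s, f s = 1 →
    ∀ g : X × ℝ → ℝ≥0∞, Measurable g →
      ∫⁻ q, f q.2 * g q ∂(shearMeasure μ) =
        ∫⁻ y, (∫⁻ s, f s ∂(σ y))⁻¹ * ∫⁻ s, g (y, s) * f s ∂(σ y) ∂(antiConv f μ)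

/-- `dim^u(μ) = δ`: leafwise measures exist and, for any choice of them,
`(1/t) log μ_x^u([-e^{-t}, e^{-t}]) → -δ` for `μ`-almost every `x`. The positivity clause
says that the logarithms are taken of positive numbers. -/
def HasLeafwiseDim (μ : Measure X) (δ : ℝ) : Prop :=
  (∃ σ : X → Measure ℝ, IsLeafwiseSystem μ σ) ∧
    ∀ σ : X → Measure ℝ, IsLeafwiseSystem μ σ →
      ∀ᵐ x ∂μ, (∀ t : ℝ, 0 < σ x (Icc (-Real.exp (-t)) (Real.exp (-t)))) ∧
        Tendsto (fun t : ℝ =>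
          1 / t * Real.log (σ x (Icc (-Real.exp (-t)) (Real.exp (-t)))).toReal)
          atTop (𝓝 (-δ))

/-- The transition law `ω_x = p(x) δ_{a(log 2) x} + (1 - p(x)) δ_{u(1) a(log 2) x}`. -/
def chainKernel (p : X → ℝ) (x : X) : Measure X :=
  ENNReal.ofReal (p x) • Measure.dirac (aB (Real.log 2) • x) +
    ENNReal.ofReal (1 - p x) • Measure.dirac (uB 1 • aB (Real.log 2) • x)

end Leafwise

end

/-! Take `x` distributed by `μ`, `s` uniform on `[0,1)` and independent, and put `y = u(-s)x`. The
law of `y` is `S_{1_[0,1)} μ`, and given `y` the law of `s` is `σ_y` restricted to `[0,1)` and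
normalised. Hence `p(y) = σ_y[0,1/2) / σ_y[0,1)` (`halfProb`) is the conditional probability that
the first binary digit of `s` is `0`.

Stationarity: `T(x,s) = (a(log 2)x, 2s mod 1)` (`skewDoubling`) preserves `μ` × Lebesgue. By
`a(t)u(s) = u(e^t s)a(t)` it moves `y` to `a(log 2)y` if the digit is `0` and to `u(1)a(log 2)y` if
it is `1`. So one step of the chain `ω` is one step of `T`, and invariance under `T` is the claim
(`bind_chainKernel`).

Dimension: the information `-log` of the conditional probability of the digit has mean `∫ H(p,1-p)`.
Since `σ_{a(t)x}` is proportional to a dilate of `σ_x`, its sums along a `T`-orbit telescope to a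
constant minus the logarithm of the `σ_x`-mass of the level-`n` dyadic interval about `s`, shifted
so that `s` becomes `0` (`ae_cellMass`). Birkhoff's theorem gives the growth rate of these sums. A
typical `s` is not exponentially close to dyadic end points (Borel–Cantelli), so the cells may be
replaced by symmetric intervals (`hasDimAtZero_of_cellMass`). The rate is thus `log 2` times the
local dimension of `σ_x` at `0`. Dilation does not change that dimension, so it is flow invariant,
hence constant by ergodicity, and integrating identifies it (`hasDimAtZero_const`).

Existence and independence of the choice: disintegrating the Cauchy-weighted shear measure gives
`condLeaf`, equivariant only almost everywhere; `leaf` repairs this on whole `u`-orbits. Every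
system is almost everywhere proportional to `condLeaf`, and `halfProb` ignores scaling. -/

open ProbabilityTheory

set_option linter.unusedSectionVars false

/-! ### Birkhoff's ergodic theorem for functions with values in `[0,∞]` -/

section Birkhoff

variable {Z : Type*} {T : Z → Z}

/-- Cut the orbit segment greedily: off `B` use a block of length at most `N` on which `h` beats
`g`; on `B` use a block of length one and pay `K`. The unfinished last piece costs at most `N * K`.
-/
theorem birkhoffSum_le_of_exists_le {g h : Z → ℝ≥0∞} {K : ℝ≥0∞} (hg : ∀ z, g z ≤ K)
    {N : ℕ} (hN : 1 ≤ N) {B : Set Z}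
    (H : ∀ z ∉ B, ∃ n, 1 ≤ n ∧ n ≤ N ∧ birkhoffSum T g n z ≤ birkhoffSum T h n z) (L : ℕ) :
    ∀ z, birkhoffSum T g L z ≤
      birkhoffSum T (fun z => h z + B.indicator (fun _ => K) z) L z + N * K := by
  induction L using Nat.strong_induction_on with
  | _ L ih =>
    intro z
    set h' : Z → ℝ≥0∞ := fun z => h z + B.indicator (fun _ => K) z with hh'
    by_cases hL : L ≤ N
    · calc birkhoffSum T g L z ≤ ∑ _k ∈ Finset.range L, K := Finset.sum_le_sum fun _ _ => hg _
        _ = L * K := by simp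
        _ ≤ N * K := by gcongr
        _ ≤ _ := le_add_self
    · have key : ∃ n, 1 ≤ n ∧ n ≤ N ∧ birkhoffSum T g n z ≤ birkhoffSum T h' n z := by
        by_cases hz : z ∈ B
        · refine ⟨1, le_rfl, hN, ?_⟩
          simp only [birkhoffSum_one, hh', indicator_of_mem hz]
          exact (hg z).trans le_add_self
        · obtain ⟨n, h1, h2, h3⟩ := H z hz
          exact ⟨n, h1, h2, h3.trans (Finset.sum_le_sum fun _ _ => le_self_add)⟩
      obtain ⟨n, h1, h2, h3⟩ := key
      obtain ⟨m, rfl⟩ : ∃ m, L = n + m := ⟨L - n, by omega⟩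
      rw [birkhoffSum_add, birkhoffSum_add, add_assoc]
      exact add_le_add h3 (ih m (by omega) _)

theorem birkhoffSum_le_of_apply_le {φ : Z → ℝ≥0∞} (hφ : ∀ z, φ (T z) ≤ φ z) (n : ℕ) (z : Z) :
    birkhoffSum T φ n z ≤ n * φ z := by
  have h : ∀ k, φ (T^[k] z) ≤ φ z := fun k => by
    induction k with
    | zero => exact le_rfl
    | succ k ih => rw [Function.iterate_succ_apply']; exact (hφ _).trans ih
  calc birkhoffSum T φ n z ≤ ∑ _k ∈ Finset.range n, φ z := Finset.sum_le_sum fun k _ => h k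
    _ = n * φ z := by simp

theorem le_birkhoffSum_of_le_apply {φ : Z → ℝ≥0∞} (hφ : ∀ z, φ z ≤ φ (T z)) (n : ℕ) (z : Z) :
    n * φ z ≤ birkhoffSum T φ n z := by
  have h : ∀ k, φ z ≤ φ (T^[k] z) := fun k => by
    induction k with
    | zero => exact le_rfl
    | succ k ih => rw [Function.iterate_succ_apply']; exact ih.trans (hφ _)
  calc n * φ z = ∑ _k ∈ Finset.range n, φ z := by simp
    _ ≤ birkhoffSum T φ n z := Finset.sum_le_sum fun k _ => h k

theorem tendsto_add_div_natCast {c K : ℝ≥0∞} (hK : K ≠ ∞) :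
    Tendsto (fun n : ℕ => c + K / n) atTop (𝓝 c) := by
  have := ENNReal.Tendsto.const_div (a := K) ENNReal.tendsto_nat_nhds_top (Or.inr hK)
  simpa using (tendsto_const_nhds (x := c)).add this

/-- Passing to `T z` drops one nonnegative term. This one-sided invariance suffices later and needs
no bound on `f`. -/
theorem limsup_birkhoffSum_apply_le (f : Z → ℝ≥0∞) (z : Z) :
    limsup (fun n : ℕ => birkhoffSum T f n (T z) / n) atTop ≤
      limsup (fun n : ℕ => birkhoffSum T f n z / n) atTop := by
  refine le_of_forall_lt fun c hc => ?_
  obtain ⟨d, hcd, hd⟩ := exists_between hc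
  obtain ⟨c', hdc', hc'⟩ := exists_between hd
  refine lt_of_lt_of_le hcd ?_
  have h1 := frequently_lt_of_lt_limsup (by isBoundedDefault) hc'
  have h2 : ∀ᶠ n : ℕ in atTop, d + d / n < c' :=
    (tendsto_add_div_natCast hdc'.ne_top).eventually (gt_mem_nhds hdc')
  have h3 : ∃ᶠ n : ℕ in atTop, d ≤ birkhoffSum T f (n + 1) z / (n + 1 : ℕ) := by
    refine (h1.and_eventually (h2.and (eventually_ge_atTop 1))).mono fun n ⟨hn, hn2, hn1⟩ => ?_
    have hn0 : (n : ℝ≥0∞) ≠ 0 := by simp; omega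
    have hnt : (n : ℝ≥0∞) ≠ ∞ := ENNReal.natCast_ne_top _
    rw [ENNReal.le_div_iff_mul_le (by simp) (by simp)]
    rw [ENNReal.lt_div_iff_mul_lt (by simp [hn0]) (by simp)] at hn
    calc d * (n + 1 : ℕ) = (d + d / n) * n := by
          rw [add_mul, ENNReal.div_mul_cancel hn0 hnt]; push_cast; ring
      _ ≤ c' * n := by gcongr
      _ ≤ birkhoffSum T f n (T z) := hn.le
      _ ≤ birkhoffSum T f (n + 1) z := by rw [birkhoffSum_succ']; exact le_add_self
  refine le_limsup_of_frequently_le ?_ (by isBoundedDefault)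
  rw [frequently_atTop] at h3 ⊢
  intro a
  obtain ⟨b, hb, hb'⟩ := h3 a
  exact ⟨b + 1, by omega, hb'⟩

/-- The dropped term is at most `K`, which is negligible after division by `n`; this is where
boundedness enters. -/
theorem liminf_birkhoffSum_le_apply {f : Z → ℝ≥0∞} {K : ℝ≥0∞} (hK : K ≠ ∞)
    (hf : ∀ z, f z ≤ K) (z : Z) :
    liminf (fun n : ℕ => birkhoffSum T f n z / n) atTop ≤
      liminf (fun n : ℕ => birkhoffSum T f n (T z) / n) atTop := by
  refine le_of_forall_lt fun c hc => ?_
  obtain ⟨d, hcd, hd⟩ := exists_between hc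
  obtain ⟨c', hdc', hc'⟩ := exists_between hd
  refine lt_of_lt_of_le hcd ?_
  have h1 := (tendsto_add_atTop_nat 1).eventually (eventually_lt_of_lt_liminf hc')
  have h2 : ∀ᶠ n : ℕ in atTop, d + K / n < c' :=
    (tendsto_add_div_natCast hK).eventually (gt_mem_nhds hdc')
  refine le_liminf_of_le (by isBoundedDefault) ?_
  filter_upwards [h1, h2, eventually_ge_atTop 1] with n hn hn2 hn1
  have hn0 : (n : ℝ≥0∞) ≠ 0 := by simp; omega
  have hnt : (n : ℝ≥0∞) ≠ ∞ := ENNReal.natCast_ne_top _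
  rw [ENNReal.le_div_iff_mul_le (by simp [hn0]) (by simp)]
  rw [ENNReal.lt_div_iff_mul_lt (by simp) (by simp)] at hn
  refine (ENNReal.add_le_add_iff_left hK).1 ?_
  calc K + d * n = (d + K / n) * n := by
        rw [add_mul, ENNReal.div_mul_cancel hn0 hnt, add_comm]
    _ ≤ c' * n := by gcongr
    _ ≤ c' * (n + 1 : ℕ) := by gcongr; simp
    _ ≤ birkhoffSum T f (n + 1) z := hn.le
    _ ≤ K + birkhoffSum T f n (T z) := by rw [birkhoffSum_succ']; gcongr; exact hf z

variable [MeasurableSpace Z] {m : Measure Z}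

theorem MeasureTheory.MeasurePreserving.lintegral_birkhoffSum (hT : MeasurePreserving T m m)
    {f : Z → ℝ≥0∞} (hf : Measurable f) (n : ℕ) :
    ∫⁻ z, birkhoffSum T f n z ∂m = n * ∫⁻ z, f z ∂m := by
  simp only [birkhoffSum]
  rw [lintegral_finsetSum (Finset.range n) (f := fun k z => f (T^[k] z))
    fun k _ => hf.comp (hT.iterate k).measurable]
  simp [(hT.iterate _).lintegral_comp hf]

theorem measurable_birkhoffSum {f : Z → ℝ≥0∞} (hT : Measurable T) (hf : Measurable f) (n : ℕ) :
    Measurable (birkhoffSum T f n) := by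
  unfold birkhoffSum
  exact Finset.measurable_fun_sum _ fun k _ => hf.comp (hT.iterate k)

/-- Comparison principle behind both halves of the ergodic theorem. Integrate the block
decomposition over length `L`, divide by `L` and let `L → ∞`; then let the admissible block length
grow, so that the exceptional sets decrease to `∅`. -/
theorem lintegral_le_of_exists_birkhoffSum_le [IsProbabilityMeasure m]
    (hT : MeasurePreserving T m m) {g h : Z → ℝ≥0∞} (hgm : Measurable g) (hhm : Measurable h)
    {K : ℝ≥0∞} (hK : K ≠ ∞) (hg : ∀ z, g z ≤ K)
    (H : ∀ z, ∃ n, 1 ≤ n ∧ birkhoffSum T g n z ≤ birkhoffSum T h n z) :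
    ∫⁻ z, g z ∂m ≤ ∫⁻ z, h z ∂m := by
  let B : ℕ → Set Z := fun N => ⋂ n ∈ Icc 1 (N + 1), {z | birkhoffSum T h n z < birkhoffSum T g n z}
  have hBm : ∀ N, MeasurableSet (B N) := fun N => by
    refine MeasurableSet.biInter (to_countable _) fun n _ => ?_
    exact measurableSet_lt (measurable_birkhoffSum hT.measurable hhm n)
      (measurable_birkhoffSum hT.measurable hgm n)
  have hBa : Antitone B := fun a b hab =>
    biInter_subset_biInter_left (Icc_subset_Icc_right (by omega))
  have hBe : ⋂ N, B N = ∅ := by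
    refine eq_empty_of_forall_notMem fun z hz => ?_
    obtain ⟨n, h1, h2⟩ := H z
    have := mem_iInter₂.1 (mem_iInter.1 hz n) n ⟨h1, by omega⟩
    exact absurd h2 (not_le.2 this)
  have hB0 : Tendsto (fun N => m (B N)) atTop (𝓝 0) := by
    have := tendsto_measure_iInter_atTop (μ := m) (fun N => (hBm N).nullMeasurableSet) hBa
      ⟨0, measure_ne_top _ _⟩
    rwa [hBe, measure_empty] at this
  have step : ∀ N, ∫⁻ z, g z ∂m ≤ ∫⁻ z, h z ∂m + K * m (B N) := by
    intro N
    set h' : Z → ℝ≥0∞ := fun z => h z + (B N).indicator (fun _ => K) z with hh'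
    have hh'm : Measurable h' := hhm.add (measurable_const.indicator (hBm N))
    have hint : ∫⁻ z, h' z ∂m = ∫⁻ z, h z ∂m + K * m (B N) := by
      rw [lintegral_add_left hhm, lintegral_indicator_const (hBm N)]
    rw [← hint]
    have h1 : ∀ L : ℕ, (L : ℝ≥0∞) * ∫⁻ z, g z ∂m ≤ L * ∫⁻ z, h' z ∂m + (N + 1 : ℕ) * K := by
      intro L
      rw [← hT.lintegral_birkhoffSum hgm, ← hT.lintegral_birkhoffSum hh'm]
      calc _ ≤ ∫⁻ z, (birkhoffSum T h' L z + (N + 1 : ℕ) * K) ∂m := by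
            refine lintegral_mono fun z => birkhoffSum_le_of_exists_le hg (by omega) ?_ L z
            intro z hz
            simp only [B, mem_iInter, not_forall, mem_ofPred_eq, not_lt] at hz
            obtain ⟨n, hn, hn'⟩ := hz
            exact ⟨n, hn.1, hn.2, hn'⟩
        _ = _ := by
            rw [lintegral_add_right _ measurable_const]; simp
    have h2 : ∀ L : ℕ, ∫⁻ z, g z ∂m ≤ ∫⁻ z, h' z ∂m + ((N + 1 : ℕ) * K) / (L + 1 : ℕ) := by
      intro L
      have hL0 : ((L + 1 : ℕ) : ℝ≥0∞) ≠ 0 := by simp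
      have hLt : ((L + 1 : ℕ) : ℝ≥0∞) ≠ ∞ := ENNReal.natCast_ne_top _
      rw [← ENNReal.mul_le_mul_iff_right hL0 hLt, mul_add, ENNReal.mul_div_cancel hL0 hLt]
      exact h1 (L + 1)
    have h3 : Tendsto (fun L : ℕ => ∫⁻ z, h' z ∂m + ((N + 1 : ℕ) * K) / (L + 1 : ℕ)) atTop
        (𝓝 (∫⁻ z, h' z ∂m + 0)) := by
      refine tendsto_const_nhds.add ?_
      have := ENNReal.Tendsto.const_div (a := (N + 1 : ℕ) * K)
        ((tendsto_add_atTop_iff_nat 1).2 ENNReal.tendsto_nat_nhds_top)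
        (Or.inr (ENNReal.mul_ne_top (ENNReal.natCast_ne_top _) hK))
      simpa using this
    rw [add_zero] at h3
    exact ge_of_tendsto' h3 h2
  have hlim : Tendsto (fun N => ∫⁻ z, h z ∂m + K * m (B N)) atTop (𝓝 (∫⁻ z, h z ∂m + K * 0)) :=
    tendsto_const_nhds.add (ENNReal.Tendsto.const_mul hB0 (Or.inr hK))
  rw [mul_zero, add_zero] at hlim
  exact ge_of_tendsto' hlim step


theorem lintegral_le_of_forall_lintegral_min_le {f : Z → ℝ≥0∞} (hf : Measurable f) {C : ℝ≥0∞}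
    (h : ∀ k : ℕ, ∫⁻ z, min (f z) k ∂m ≤ C) : ∫⁻ z, f z ∂m ≤ C := by
  have hsup : ∀ z, f z = ⨆ k : ℕ, min (f z) k := fun z => by
    have := (inf_iSup_eq (f z) (fun k : ℕ => (k : ℝ≥0∞)))
    rw [ENNReal.iSup_natCast, inf_top_eq] at this
    exact this
  simp_rw +singlePass [hsup]
  rw [lintegral_iSup (fun k => hf.min measurable_const)]
  · exact iSup_le h
  · intro a b hab z
    exact min_le_min le_rfl (by exact_mod_cast hab)

/-- The function `c * min (limsup) k` with `c < 1` does not increase along orbits and lies strictly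
below the limsup where it is positive, so some average of `f` exceeds it and the comparison
principle applies. -/
theorem lintegral_limsup_birkhoffSum_le [IsProbabilityMeasure m]
    (hT : MeasurePreserving T m m) {f : Z → ℝ≥0∞} (hf : Measurable f) :
    ∫⁻ z, limsup (fun n : ℕ => birkhoffSum T f n z / n) atTop ∂m ≤ ∫⁻ z, f z ∂m := by
  set F : Z → ℝ≥0∞ := fun z => limsup (fun n : ℕ => birkhoffSum T f n z / n) atTop with hF
  have hFm : Measurable F :=
    Measurable.limsup fun n => (measurable_birkhoffSum hT.measurable hf n).div_const _
  refine lintegral_le_of_forall_lintegral_min_le hFm fun k => ?_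
  refine ENNReal.le_of_forall_nnreal_lt fun r hr => ?_
  by_cases hr0 : r = 0
  · simp [hr0]
  have hk : ∀ c : ℝ≥0∞, c < 1 → c * ∫⁻ z, min (F z) k ∂m ≤ ∫⁻ z, f z ∂m := by
    intro c hc
    rw [← lintegral_const_mul _ (hFm.min measurable_const)]
    refine lintegral_le_of_exists_birkhoffSum_le hT ((hFm.min measurable_const).const_mul _) hf
      (K := k) (ENNReal.natCast_ne_top _) (fun z => ?_) fun z => ?_
    · calc c * min (F z) k ≤ 1 * k := by gcongr; exact min_le_right _ _
        _ = k := one_mul _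
    · have hle : ∀ n : ℕ, birkhoffSum T (fun z => c * min (F z) k) n z ≤ n * (c * min (F z) k) :=
        fun n => birkhoffSum_le_of_apply_le (φ := fun z => c * min (F z) k) (fun z => by
          gcongr; exact limsup_birkhoffSum_apply_le f z) n z
      by_cases h0 : min (F z) k = 0
      · exact ⟨1, le_rfl, (hle 1).trans (by simp [h0])⟩
      have hlt : c * min (F z) k < F z := by
        refine lt_of_lt_of_le ?_ (min_le_left _ (k : ℝ≥0∞))
        have := ENNReal.mul_lt_mul_left h0
          ((min_le_right _ _).trans_lt (ENNReal.natCast_lt_top k)).ne hc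
        rwa [one_mul] at this
      obtain ⟨n, hn, hn1⟩ := ((frequently_lt_of_lt_limsup (by isBoundedDefault) hlt).and_eventually
        (eventually_ge_atTop 1)).exists
      refine ⟨n, hn1, (hle n).trans ?_⟩
      rw [mul_comm]
      have hn0 : (n : ℝ≥0∞) ≠ 0 := by simp; omega
      exact ((ENNReal.lt_div_iff_mul_lt (by simp [hn0]) (by simp)).1 hn).le
  have hI : ∫⁻ z, min (F z) k ∂m ≠ 0 := (bot_le.trans_lt hr).ne'
  have hIt : ∫⁻ z, min (F z) k ∂m ≠ ∞ := by
    refine ne_top_of_le_ne_top (ENNReal.natCast_ne_top k) ?_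
    calc _ ≤ ∫⁻ _z, (k : ℝ≥0∞) ∂m := lintegral_mono fun z => min_le_right _ _
      _ = k := by simp
  -- Every `r` below the integral is `c` times the integral for some `c < 1`.
  have := hk (r / ∫⁻ z, min (F z) k ∂m) ((ENNReal.div_lt_iff (by simp [hI]) (by simp [hIt])).2
    (by rwa [one_mul]))
  rwa [ENNReal.div_mul_cancel hI hIt] at this

/-- Truncating `f` makes its liminf nondecreasing along orbits; adding `ε` makes it exceed some
average of the truncation. -/
theorem le_lintegral_liminf_birkhoffSum [IsProbabilityMeasure m]
    (hT : MeasurePreserving T m m) {f : Z → ℝ≥0∞} (hf : Measurable f) :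
    ∫⁻ z, f z ∂m ≤ ∫⁻ z, liminf (fun n : ℕ => birkhoffSum T f n z / n) atTop ∂m := by
  refine lintegral_le_of_forall_lintegral_min_le hf fun k => ?_
  set f' : Z → ℝ≥0∞ := fun z => min (f z) k with hf'
  have hf'm : Measurable f' := hf.min measurable_const
  have hf'k : ∀ z, f' z ≤ k := fun z => min_le_right _ _
  set F : Z → ℝ≥0∞ := fun z => liminf (fun n : ℕ => birkhoffSum T f' n z / n) atTop with hF
  have hFm : Measurable F :=
    Measurable.liminf fun n => (measurable_birkhoffSum hT.measurable hf'm n).div_const _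
  have hFk : ∀ z, F z ≤ k := fun z => by
    refine liminf_le_of_le (by isBoundedDefault) fun b hb => ?_
    obtain ⟨n, hn, hn1⟩ := (hb.and (eventually_ge_atTop 1)).exists
    refine hn.trans (ENNReal.div_le_of_le_mul ?_)
    rw [mul_comm]
    calc birkhoffSum T f' n z ≤ ∑ _k ∈ Finset.range n, (k : ℝ≥0∞) :=
          Finset.sum_le_sum fun _ _ => hf'k _
      _ = n * k := by simp
  have h1 : ∫⁻ z, f' z ∂m ≤ ∫⁻ z, F z ∂m := by
    refine ENNReal.le_of_forall_pos_le_add fun ε hε _ => ?_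
    calc ∫⁻ z, f' z ∂m ≤ ∫⁻ z, (F z + ε) ∂m := by
          refine lintegral_le_of_exists_birkhoffSum_le hT hf'm (hFm.add_const _)
            (ENNReal.natCast_ne_top k) hf'k fun z => ?_
          have hlt : F z < F z + ε := ENNReal.lt_add_right
            (ne_top_of_le_ne_top (ENNReal.natCast_ne_top k) (hFk z)) (by simpa using hε.ne')
          obtain ⟨n, hn, hn1⟩ := ((frequently_lt_of_liminf_lt (by isBoundedDefault)
            hlt).and_eventually (eventually_ge_atTop 1)).exists
          refine ⟨n, hn1, ?_⟩
          have hn0 : (n : ℝ≥0∞) ≠ 0 := by simp; omega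
          refine le_trans ?_ (le_birkhoffSum_of_le_apply (φ := fun z => F z + ε) (fun z => by
            gcongr; exact liminf_birkhoffSum_le_apply (ENNReal.natCast_ne_top k) hf'k z) n z)
          rw [mul_comm]
          exact ((ENNReal.div_lt_iff (by simp [hn0]) (by simp)).1 hn).le
      _ = _ := by rw [lintegral_add_right _ measurable_const]; simp
  refine h1.trans (lintegral_mono fun z => liminf_le_liminf (Eventually.of_forall fun n => ?_))
  gcongr
  exact Finset.sum_le_sum fun _ _ => min_le_left _ _

/-- Birkhoff's pointwise ergodic theorem for nonnegative functions. -/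
theorem exists_tendsto_birkhoffSum_div [IsProbabilityMeasure m]
    (hT : MeasurePreserving T m m) {f : Z → ℝ≥0∞} (hf : Measurable f) (hfi : ∫⁻ z, f z ∂m ≠ ∞) :
    ∃ g : Z → ℝ≥0∞, Measurable g ∧
      (∀ᵐ z ∂m, g z ≠ ∞ ∧ Tendsto (fun n : ℕ => birkhoffSum T f n z / n) atTop (𝓝 (g z))) ∧
      ∫⁻ z, g z ∂m = ∫⁻ z, f z ∂m := by
  have hum : Measurable fun z => limsup (fun n : ℕ => birkhoffSum T f n z / n) atTop :=
    Measurable.limsup fun n => (measurable_birkhoffSum hT.measurable hf n).div_const _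
  have hlm : Measurable fun z => liminf (fun n : ℕ => birkhoffSum T f n z / n) atTop :=
    Measurable.liminf fun n => (measurable_birkhoffSum hT.measurable hf n).div_const _
  have hu := lintegral_limsup_birkhoffSum_le hT hf
  have hl := le_lintegral_liminf_birkhoffSum hT hf
  have hle : ∀ z, liminf (fun n : ℕ => birkhoffSum T f n z / n) atTop ≤
    limsup (fun n : ℕ => birkhoffSum T f n z / n) atTop := fun z => liminf_le_limsup
  have hlf := ne_top_of_le_ne_top hfi ((lintegral_mono (μ := m) hle).trans hu)
  -- Liminf and limsup are ordered pointwise, but their integrals are ordered the other way; so they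
  -- agree almost everywhere.
  have heq := ae_eq_of_ae_le_of_lintegral_le (Eventually.of_forall hle) hlf hum.aemeasurable
    (hu.trans hl)
  refine ⟨_, hum, ?_, le_antisymm hu (hl.trans (lintegral_mono hle))⟩
  filter_upwards [heq, ae_lt_top hum (ne_top_of_le_ne_top hfi hu)] with z hz hz'
  exact ⟨hz'.ne, tendsto_of_liminf_eq_limsup hz rfl⟩

end Birkhoff

/-! ### Commutation relations in `B` -/

section Group

theorem uB_zero : uB 0 = 1 := by
  apply Subtype.ext; apply Subtype.ext
  ext i j; fin_cases i <;> fin_cases j <;> simp [uB, uMat]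

theorem uB_add (s t : ℝ) : uB (s + t) = uB s * uB t := by
  apply Subtype.ext
  change uMat (s + t) = uMat s * uMat t
  apply Subtype.ext
  rw [Matrix.SpecialLinearGroup.coe_mul]
  simp [uMat, add_comm]

theorem aB_mul_uB (t s : ℝ) : aB t * uB s = uB (Real.exp t * s) * aB t := by
  have h : Real.exp t = Real.exp (t / 2) * Real.exp (t / 2) := by rw [← Real.exp_add]; ring_nf
  have h' : Real.exp (t / 2) * Real.exp (-t / 2) = 1 := by rw [← Real.exp_add]; ring_nf; simp
  apply Subtype.ext
  change aMat t * uMat s = uMat (Real.exp t * s) * aMat t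
  apply Subtype.ext
  rw [Matrix.SpecialLinearGroup.coe_mul, Matrix.SpecialLinearGroup.coe_mul]
  have h2 : Real.exp (t / 2) * s = Real.exp t * s * Real.exp (-t / 2) := by
    rw [h]; linear_combination (-Real.exp (t / 2) * s) * h'
  simp [aMat, uMat, h2]

theorem continuous_uB : Continuous uB := by
  refine Continuous.subtype_mk (Continuous.subtype_mk ?_ _) _
  refine continuous_matrix fun i j => ?_
  fin_cases i <;> fin_cases j <;> simp <;> fun_prop

variable {X : Type*} [MulAction BGroup X]

theorem uB_smul_uB_smul (s t : ℝ) (x : X) : uB s • uB t • x = uB (s + t) • x := by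
  rw [smul_smul, uB_add]

theorem aB_smul_aB_smul (s t : ℝ) (x : X) : aB s • aB t • x = aB (s + t) • x := by
  rw [smul_smul, aB_add]

@[simp] theorem uB_zero_smul (x : X) : uB 0 • x = x := by rw [uB_zero, one_smul]

@[simp] theorem aB_zero_smul (x : X) : aB 0 • x = x := by rw [aB_zero, one_smul]

theorem aB_smul_uB_smul (t s : ℝ) (x : X) :
    aB t • uB s • x = uB (Real.exp t * s) • aB t • x := by
  rw [smul_smul, smul_smul, aB_mul_uB]

end Group


/-! ### Symmetries of the shear measure -/

section Shear

variable {X : Type*} [TopologicalSpace X] [SecondCountableTopology X] [MeasurableSpace X]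
  [BorelSpace X] [MulAction BGroup X] [ContinuousSMul BGroup X]

theorem measurable_uB_smul : Measurable fun q : ℝ × X => uB q.1 • q.2 :=
  Continuous.measurable ((continuous_uB.comp continuous_fst).smul continuous_snd)

@[fun_prop]
theorem Measurable.uB_smul {Y : Type*} [MeasurableSpace Y] {f : Y → ℝ} {g : Y → X}
    (hf : Measurable f) (hg : Measurable g) : Measurable fun y => uB (f y) • g y :=
  measurable_uB_smul.comp (hf.prodMk hg)

@[fun_prop]
theorem Measurable.aB_smul {Y : Type*} [MeasurableSpace Y] {g : Y → X} (t : ℝ)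
    (hg : Measurable g) : Measurable fun y => aB t • g y :=
  (continuous_const_smul (aB t)).measurable.comp hg

theorem measurable_shear : Measurable fun q : X × ℝ => (uB (-q.2) • q.1, q.2) := by fun_prop

variable (μ : Measure X) [IsProbabilityMeasure μ]

theorem lintegral_shearMeasure {g : X × ℝ → ℝ≥0∞} (hg : Measurable g) :
    ∫⁻ q, g q ∂(shearMeasure μ) = ∫⁻ x, ∫⁻ s, g (uB (-s) • x, s) ∂volume ∂μ := by
  rw [shearMeasure, lintegral_map hg measurable_shear, lintegral_prod]
  exact (hg.comp measurable_shear).aemeasurable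

theorem lintegral_shearMeasure_symm {g : X × ℝ → ℝ≥0∞} (hg : Measurable g) :
    ∫⁻ q, g q ∂(shearMeasure μ) = ∫⁻ s, ∫⁻ x, g (uB (-s) • x, s) ∂μ := by
  rw [shearMeasure, lintegral_map hg measurable_shear, lintegral_prod_symm]
  exact (hg.comp measurable_shear).aemeasurable

theorem measurable_map_uB_smul :
    Measurable fun s : ℝ => μ.map fun x : X => uB (-s) • x := by
  refine Measure.measurable_of_measurable_coe _ fun E hE => ?_
  have h : ∀ s : ℝ, (μ.map fun x : X => uB (-s) • x) E = μ ((fun x : X => uB (-s) • x) ⁻¹' E) :=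
    fun s => Measure.map_apply (by fun_prop) hE
  simp_rw [h]
  exact measurable_measure_prodMk_left
    (s := (fun q : ℝ × X => uB (-q.1) • q.2) ⁻¹' E) ((by fun_prop : Measurable _) hE)

theorem lintegral_antiConv {f : ℝ → ℝ≥0} (hf : Measurable f) {h : X → ℝ≥0∞} (hh : Measurable h) :
    ∫⁻ y, h y ∂(antiConv f μ) = ∫⁻ q, f q.2 * h q.1 ∂(shearMeasure μ) := by
  rw [lintegral_shearMeasure_symm μ (by fun_prop), antiConv,
    Measure.lintegral_bind (measurable_map_uB_smul μ).aemeasurable hh.aemeasurable,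
    lintegral_withDensity_eq_lintegral_mul _ (by fun_prop)
      (g := fun s => ∫⁻ x, h x ∂(μ.map fun x => uB (-s) • x))
      ((Measure.measurable_lintegral hh).comp (measurable_map_uB_smul μ))]
  refine lintegral_congr fun s => ?_
  simp only [Pi.mul_apply]
  rw [lintegral_map hh (by fun_prop), lintegral_const_mul _ (by fun_prop)]

theorem isProbabilityMeasure_antiConv {f : ℝ → ℝ≥0} (hf : Measurable f) (h1 : ∫⁻ s, f s = 1) :
    IsProbabilityMeasure (antiConv f μ) := by
  refine ⟨?_⟩
  rw [← lintegral_one, lintegral_antiConv μ hf measurable_const,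
    lintegral_shearMeasure μ (by fun_prop)]
  simp [h1]

/-- For fixed `x`, replacing `(y, s)` by `(u(t)y, s - t)` only reparametrises the orbit of `x`, so
translation invariance of Lebesgue measure is enough; `μ` need not be `u`-invariant. -/
theorem lintegral_shearMeasure_uB (t : ℝ) {g : X × ℝ → ℝ≥0∞} (hg : Measurable g) :
    ∫⁻ q, g (uB t • q.1, q.2 - t) ∂(shearMeasure μ) = ∫⁻ q, g q ∂(shearMeasure μ) := by
  rw [lintegral_shearMeasure μ hg, lintegral_shearMeasure μ (g := fun q => g (uB t • q.1, q.2 - t))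
    (by fun_prop)]
  refine lintegral_congr fun x => ?_
  rw [← lintegral_sub_right_eq_self (fun s => g (uB (-s) • x, s)) t]
  simp_rw [uB_smul_uB_smul]
  refine lintegral_congr fun s => ?_
  rw [show -(s - t) = t + -s by ring]

theorem measurePreserving_aB_smul [SMulInvariantMeasure aSubgroup X μ] (t : ℝ) :
    MeasurePreserving (fun x : X => aB t • x) μ μ :=
  ⟨by fun_prop, by
    ext E hE
    rw [Measure.map_apply (by fun_prop) hE]
    exact SMulInvariantMeasure.measure_preimage_smul (⟨aB t, t, rfl⟩ : aSubgroup) hE⟩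

theorem lintegral_comp_aB_smul [SMulInvariantMeasure aSubgroup X μ] (t : ℝ) {h : X → ℝ≥0∞}
    (hh : Measurable h) : ∫⁻ x, h (aB t • x) ∂μ = ∫⁻ x, h x ∂μ :=
  (measurePreserving_aB_smul μ t).lintegral_comp hh

/-- Conjugation by `a(t)` turns `u(-s)` into `u(-e^t s)`; invariance of `μ` absorbs `a(t)`, and
dilating Lebesgue measure produces the factor `e^{-t}`. -/
theorem lintegral_shearMeasure_aB [SMulInvariantMeasure aSubgroup X μ] (t : ℝ)
    {g : X × ℝ → ℝ≥0∞} (hg : Measurable g) :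
    ∫⁻ q, g (aB t • q.1, Real.exp t * q.2) ∂(shearMeasure μ) =
      ENNReal.ofReal (Real.exp (-t)) * ∫⁻ q, g q ∂(shearMeasure μ) := by
  rw [lintegral_shearMeasure_symm μ hg,
    lintegral_shearMeasure_symm μ (g := fun q => g (aB t • q.1, Real.exp t * q.2)) (by fun_prop)]
  have h : ∀ s : ℝ, ∫⁻ x, g (aB t • uB (-s) • x, Real.exp t * s) ∂μ =
      ∫⁻ x, g (uB (-(Real.exp t * s)) • x, Real.exp t * s) ∂μ := fun s => by
    rw [← lintegral_comp_aB_smul μ t (h := fun x => g (uB (-(Real.exp t * s)) • x, Real.exp t * s))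
      (by fun_prop)]
    simp_rw [aB_smul_uB_smul, mul_neg]
  simp_rw [h]
  have hm : Measurable fun s : ℝ => ∫⁻ x, g (uB (-s) • x, s) ∂μ :=
    Measurable.lintegral_prod_right' (f := fun q : ℝ × X => g (uB (-q.1) • q.2, q.1)) (by fun_prop)
  have h0 : Real.exp t ≠ 0 := (Real.exp_pos t).ne'
  have := Real.map_volume_mul_left h0
  calc ∫⁻ s : ℝ, ∫⁻ x, g (uB (-(Real.exp t * s)) • x, Real.exp t * s) ∂μ
      = ∫⁻ s, ∫⁻ x, g (uB (-s) • x, s) ∂μ ∂(Measure.map (Real.exp t * ·) volume) := by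
        rw [lintegral_map hm (by fun_prop)]
    _ = _ := by
        rw [this, lintegral_smul_measure, smul_eq_mul, Real.exp_neg,
          abs_of_pos (inv_pos.2 (Real.exp_pos t))]

end Shear

/-! ### The Cauchy density as normalising weight; proportional measures -/

section CauchyWeight

/-- The density of the standard Cauchy distribution. -/
noncomputable def cauchyWeight (s : ℝ) : ℝ≥0 := (Real.pi⁻¹ * (1 + s ^ 2)⁻¹).toNNReal

theorem continuous_cauchyWeight : Continuous cauchyWeight := by
  unfold cauchyWeight
  refine continuous_real_toNNReal.comp (continuous_const.mul (Continuous.inv₀ (by fun_prop) ?_))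
  intro s; positivity

@[fun_prop]
theorem measurable_cauchyWeight : Measurable cauchyWeight := continuous_cauchyWeight.measurable

theorem cauchyWeight_pos (s : ℝ) : 0 < cauchyWeight s := by
  rw [cauchyWeight, Real.toNNReal_pos]; positivity

theorem cauchyWeight_ne_zero (s : ℝ) : (cauchyWeight s : ℝ≥0∞) ≠ 0 := by
  simpa using (cauchyWeight_pos s).ne'

theorem lintegral_cauchyWeight : ∫⁻ s, cauchyWeight s = 1 := by
  have h := ofReal_integral_eq_lintegral_ofReal (μ := volume)
    (f := fun s : ℝ => Real.pi⁻¹ * (1 + s ^ 2)⁻¹) (integrable_inv_one_add_sq.const_mul _)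
    (Eventually.of_forall fun s => by positivity)
  rw [integral_const_mul, integral_univ_inv_one_add_sq, inv_mul_cancel₀ Real.pi_ne_zero,
    ENNReal.ofReal_one] at h
  exact h.symm

/-- The reason for choosing this weight: polynomial decay costs only a constant under affine
substitutions, so finiteness of the weighted mass survives translations and dilations. -/
theorem exists_cauchyWeight_affine_le {b : ℝ} (hb : b ≠ 0) (c : ℝ) :
    ∃ C : ℝ≥0, ∀ s, cauchyWeight (b * s + c) ≤ C * cauchyWeight s := by
  have hC : 0 ≤ 1 + 2 * (1 + c ^ 2) / b ^ 2 := by positivity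
  refine ⟨(1 + 2 * (1 + c ^ 2) / b ^ 2).toNNReal, fun s => ?_⟩
  rw [← NNReal.coe_le_coe, NNReal.coe_mul, cauchyWeight, cauchyWeight,
    Real.coe_toNNReal _ (by positivity), Real.coe_toNNReal _ hC, Real.coe_toNNReal _ (by positivity)]
  rw [mul_left_comm]
  refine mul_le_mul_of_nonneg_left ?_ (by positivity)
  rw [← div_eq_mul_inv, inv_eq_one_div, div_le_div_iff₀ (by positivity) (by positivity), one_mul]
  have hb2 : 0 < b ^ 2 := by positivity
  have h1 : s ^ 2 ≤ 2 * ((b * s + c) ^ 2 + c ^ 2) / b ^ 2 := by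
    rw [le_div_iff₀ hb2]; nlinarith [sq_nonneg (b * s + 2 * c)]
  have h2 : 2 * ((b * s + c) ^ 2 + c ^ 2) / b ^ 2 ≤
      2 * (1 + c ^ 2) / b ^ 2 * (1 + (b * s + c) ^ 2) := by
    rw [div_mul_eq_mul_div]
    refine div_le_div_of_nonneg_right ?_ hb2.le
    nlinarith [sq_nonneg (b * s + c), mul_nonneg (sq_nonneg c) (sq_nonneg (b * s + c))]
  nlinarith [sq_nonneg (b * s + c)]

/-- The affine map `r ↦ b * r + c`. -/
def aff (b c r : ℝ) : ℝ := b * r + c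

@[fun_prop]
theorem measurable_aff (b c : ℝ) : Measurable (aff b c) := by unfold aff; fun_prop

theorem map_aff_map_aff (b c b' c' : ℝ) (ν : Measure ℝ) :
    (ν.map (aff b' c')).map (aff b c) = ν.map (aff (b * b') (b * c' + c)) := by
  rw [Measure.map_map (measurable_aff _ _) (measurable_aff _ _)]
  congr 1; ext r; simp only [Function.comp, aff]; ring

@[simp] theorem map_aff_one_zero (ν : Measure ℝ) : ν.map (aff 1 0) = ν := by
  have : aff 1 0 = id := by ext r; simp [aff]
  rw [this, Measure.map_id]

theorem sub_eq_aff (s : ℝ) : (fun r : ℝ => r - s) = aff 1 (-s) := by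
  ext r; simp [aff, sub_eq_add_neg]

/-- The total mass of `ν` weighted by the Cauchy density. -/
noncomputable def wMass (ν : Measure ℝ) : ℝ≥0∞ := ∫⁻ s, cauchyWeight s ∂ν

/-- Measures on `ℝ` with positive finite integral against the Cauchy density. -/
def Tame (ν : Measure ℝ) : Prop := wMass ν ≠ 0 ∧ wMass ν ≠ ∞

/-- The multiple of `ν` with weighted mass one. -/
noncomputable def wNormalize (ν : Measure ℝ) : Measure ℝ := (wMass ν)⁻¹ • ν

theorem measurable_wMass : Measurable wMass := Measure.measurable_lintegral (by fun_prop)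

theorem wMass_smul (c : ℝ≥0∞) (ν : Measure ℝ) : wMass (c • ν) = c * wMass ν := by
  rw [wMass, lintegral_smul_measure]; rfl

theorem wMass_eq_zero {ν : Measure ℝ} (h : wMass ν = 0) : ν = 0 := by
  rw [wMass, lintegral_eq_zero_iff (by fun_prop)] at h
  have : ∀ᵐ s ∂ν, False := h.mono fun s hs => cauchyWeight_ne_zero s hs
  simpa using this

theorem wMass_map_aff_ne_top {b : ℝ} (hb : b ≠ 0) (c : ℝ) {ν : Measure ℝ} (h : wMass ν ≠ ∞) :
    wMass (ν.map (aff b c)) ≠ ∞ := by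
  obtain ⟨C, hC⟩ := exists_cauchyWeight_affine_le hb c
  rw [wMass, lintegral_map (by fun_prop) (by fun_prop)]
  refine ne_top_of_le_ne_top (ENNReal.mul_ne_top (ENNReal.coe_ne_top (r := C)) h) ?_
  rw [wMass, ← lintegral_const_mul _ (by fun_prop)]
  exact lintegral_mono fun s => by rw [← ENNReal.coe_mul]; exact ENNReal.coe_le_coe.2 (hC s)

theorem Tame.map_aff {ν : Measure ℝ} (h : Tame ν) {b : ℝ} (hb : b ≠ 0) (c : ℝ) :
    Tame (ν.map (aff b c)) := by
  refine ⟨fun h0 => h.1 ?_, wMass_map_aff_ne_top hb c h.2⟩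
  have h1 := wMass_eq_zero h0
  have h2 : ν = 0 := by
    rw [← map_aff_one_zero ν, show aff 1 0 = aff (b⁻¹ * b) (b⁻¹ * c + -(b⁻¹ * c)) by
      rw [inv_mul_cancel₀ hb, add_neg_cancel], ← map_aff_map_aff, h1, Measure.map_zero]
  simp [h2, wMass]

theorem Tame.locallyFinite {ν : Measure ℝ} (h : Tame ν) : IsLocallyFiniteMeasure ν := by
  refine ⟨fun x => ?_⟩
  refine ⟨Metric.ball x 1, Metric.ball_mem_nhds x one_pos, ?_⟩
  obtain ⟨z, -, hz⟩ := (isCompact_closedBall x 1).exists_isMinOn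
    ⟨x, Metric.mem_closedBall_self zero_le_one⟩ continuous_cauchyWeight.continuousOn
  have h1 : (cauchyWeight z : ℝ≥0∞) * ν (Metric.ball x 1) ≤ wMass ν := by
    calc _ = ∫⁻ _s in Metric.ball x 1, cauchyWeight z ∂ν := by simp
      _ ≤ ∫⁻ s in Metric.ball x 1, cauchyWeight s ∂ν :=
          setLIntegral_mono (by fun_prop) fun s hs => by
            exact_mod_cast hz (Metric.ball_subset_closedBall hs)
      _ ≤ _ := setLIntegral_le_lintegral _ _
  by_contra hc
  rw [not_lt, top_le_iff] at hc
  rw [hc, ENNReal.mul_top (cauchyWeight_ne_zero z), top_le_iff] at h1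
  exact h.2 h1

theorem MeasProp.refl (ν : Measure ℝ) : MeasProp ν ν := ⟨1, one_ne_zero, (one_smul _ _).symm⟩

theorem MeasProp.symm {ν₁ ν₂ : Measure ℝ} (h : MeasProp ν₁ ν₂) : MeasProp ν₂ ν₁ := by
  obtain ⟨c, hc, rfl⟩ := h
  exact ⟨c⁻¹, inv_ne_zero hc, by rw [smul_smul, inv_mul_cancel₀ hc, one_smul]⟩

theorem MeasProp.trans {ν₁ ν₂ ν₃ : Measure ℝ} (h : MeasProp ν₁ ν₂) (h' : MeasProp ν₂ ν₃) :
    MeasProp ν₁ ν₃ := by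
  obtain ⟨c, hc, rfl⟩ := h
  obtain ⟨d, hd, rfl⟩ := h'
  exact ⟨c * d, mul_ne_zero hc hd, by rw [smul_smul]⟩

theorem MeasProp.map {ν₁ ν₂ : Measure ℝ} (h : MeasProp ν₁ ν₂) (f : ℝ → ℝ) :
    MeasProp (ν₁.map f) (ν₂.map f) := by
  obtain ⟨c, hc, rfl⟩ := h
  exact ⟨c, hc, by rw [Measure.map_smul]⟩

theorem MeasProp.wNormalize_eq {ν₁ ν₂ : Measure ℝ} (h : MeasProp ν₁ ν₂) :
    wNormalize ν₁ = wNormalize ν₂ := by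
  obtain ⟨c, hc, rfl⟩ := h
  have hc' : (c : ℝ≥0∞) ≠ 0 := by simpa using hc
  have : c • ν₂ = (c : ℝ≥0∞) • ν₂ := rfl
  rw [wNormalize, wNormalize, this, wMass_smul, smul_smul,
    ENNReal.mul_inv (Or.inl hc') (Or.inl ENNReal.coe_ne_top), mul_right_comm,
    ENNReal.inv_mul_cancel hc' ENNReal.coe_ne_top, one_mul]

theorem measProp_smul {c : ℝ≥0∞} (h0 : c ≠ 0) (ht : c ≠ ∞) (ν : Measure ℝ) :
    MeasProp (c • ν) ν := by
  lift c to ℝ≥0 using ht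
  exact ⟨c, by simpa using h0, rfl⟩

theorem Tame.measProp_wNormalize {ν : Measure ℝ} (h : Tame ν) : MeasProp (wNormalize ν) ν :=
  measProp_smul (ENNReal.inv_ne_zero.2 h.2) (ENNReal.inv_ne_top.2 h.1) ν

theorem MeasProp.tame {ν₁ ν₂ : Measure ℝ} (h : MeasProp ν₁ ν₂) (h' : Tame ν₂) : Tame ν₁ := by
  obtain ⟨c, hc, rfl⟩ := h
  have : c • ν₂ = (c : ℝ≥0∞) • ν₂ := rfl
  rw [Tame, this, wMass_smul]
  exact ⟨mul_ne_zero (by simpa using hc) h'.1, ENNReal.mul_ne_top ENNReal.coe_ne_top h'.2⟩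

theorem tame_of_wMass_eq_one {ν : Measure ℝ} (h : wMass ν = 1) : Tame ν := by
  simp [Tame, h]

theorem smul_eq_wNormalize {c : ℝ≥0∞} {ν : Measure ℝ} (h : wMass (c • ν) = 1) :
    c • ν = wNormalize ν := by
  rw [wMass_smul] at h
  rw [wNormalize, ENNReal.eq_inv_of_mul_eq_one_left h]

end CauchyWeight

/-! ### Disintegration of the shear measure and its uniqueness -/

section BaseSystem

variable {X : Type*} [TopologicalSpace X] [SecondCountableTopology X] [MeasurableSpace X]
  [BorelSpace X] [MulAction BGroup X] [ContinuousSMul BGroup X]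
  (μ : Measure X) [IsProbabilityMeasure μ]

/-- The probability measure on `X × ℝ` with Cauchy density with respect to `shearMeasure μ`. -/
noncomputable def cauchyShear : Measure (X × ℝ) :=
  (shearMeasure μ).withDensity fun q => (cauchyWeight q.2 : ℝ≥0∞)

theorem cauchyShear_fst : (cauchyShear μ).fst = antiConv cauchyWeight μ := by
  ext E hE
  rw [Measure.fst_apply hE, cauchyShear, withDensity_apply _ (measurable_fst hE),
    ← lintegral_indicator_one hE,
    lintegral_antiConv μ measurable_cauchyWeight (measurable_one.indicator hE),
    ← lintegral_indicator (measurable_fst hE)]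
  refine lintegral_congr fun q => ?_
  by_cases hq : q.1 ∈ E <;> simp [indicator, hq]

instance : IsProbabilityMeasure (antiConv cauchyWeight μ) :=
  isProbabilityMeasure_antiConv μ measurable_cauchyWeight lintegral_cauchyWeight

instance : IsFiniteMeasure (cauchyShear μ) := by
  refine ⟨?_⟩
  rw [← Measure.fst_univ, cauchyShear_fst]
  exact measure_lt_top _ _

/-- A measurable choice of leafwise measures, equivariant only almost everywhere: the conditional
measures of `cauchyShear μ` over its first marginal, with the Cauchy density divided out. -/
noncomputable def condLeaf (y : X) : Measure ℝ :=
  ((cauchyShear μ).condKernel y).withDensity fun s => (cauchyWeight s : ℝ≥0∞)⁻¹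

theorem measurable_lintegral_condKernel {Y : Type*} [MeasurableSpace Y] {θ : Y → X}
    (hθ : Measurable θ) {g : Y × ℝ → ℝ≥0∞} (hg : Measurable g) :
    Measurable fun y => ∫⁻ s, g (y, s) ∂((cauchyShear μ).condKernel (θ y)) :=
  Measurable.lintegral_kernel_prod_right' (κ := (cauchyShear μ).condKernel.comap θ hθ) hg

theorem lintegral_condLeaf {g : ℝ → ℝ≥0∞} (hg : Measurable g) (y : X) :
    ∫⁻ s, g s ∂(condLeaf μ y) =
      ∫⁻ s, (cauchyWeight s : ℝ≥0∞)⁻¹ * g s ∂((cauchyShear μ).condKernel y) := by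
  rw [condLeaf, lintegral_withDensity_eq_lintegral_mul _ (by fun_prop) hg]
  rfl

theorem measurable_lintegral_condLeaf {Y : Type*} [MeasurableSpace Y] {θ : Y → X}
    (hθ : Measurable θ) {g : Y × ℝ → ℝ≥0∞} (hg : Measurable g) :
    Measurable fun y => ∫⁻ s, g (y, s) ∂(condLeaf μ (θ y)) := by
  have h : ∀ y, ∫⁻ s, g (y, s) ∂(condLeaf μ (θ y)) =
      ∫⁻ s, (cauchyWeight s : ℝ≥0∞)⁻¹ * g (y, s) ∂((cauchyShear μ).condKernel (θ y)) :=
    fun y => lintegral_condLeaf μ (by fun_prop) (θ y)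
  simp_rw [h]
  exact measurable_lintegral_condKernel μ hθ
    (g := fun q : Y × ℝ => (cauchyWeight q.2 : ℝ≥0∞)⁻¹ * g q) (by fun_prop)

theorem measurable_map_aff_condLeaf {Y : Type*} [MeasurableSpace Y] {θ : Y → X}
    (hθ : Measurable θ) {b c : Y → ℝ} (hb : Measurable b) (hc : Measurable c) :
    Measurable fun y => (condLeaf μ (θ y)).map (aff (b y) (c y)) := by
  refine Measure.measurable_of_measurable_coe _ fun E hE => ?_
  have hS : Measurable fun q : Y × ℝ => aff (b q.1) (c q.1) q.2 := by unfold aff; fun_prop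
  have h : ∀ y, ((condLeaf μ (θ y)).map (aff (b y) (c y))) E =
      ∫⁻ s, E.indicator 1 (aff (b y) (c y) s) ∂(condLeaf μ (θ y)) := fun y => by
    rw [← lintegral_indicator_one hE, lintegral_map (measurable_one.indicator hE) (by fun_prop)]
  simp_rw [h]
  exact measurable_lintegral_condLeaf μ hθ ((measurable_one.indicator hE).comp hS)

theorem measurable_condLeaf : Measurable (condLeaf μ) := by
  simpa using measurable_map_aff_condLeaf μ measurable_id
    (measurable_const (a := (1 : ℝ))) (measurable_const (a := (0 : ℝ)))

theorem wMass_condLeaf (y : X) : wMass (condLeaf μ y) = 1 := by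
  rw [wMass, lintegral_condLeaf μ (by fun_prop)]
  simp_rw [ENNReal.inv_mul_cancel (cauchyWeight_ne_zero _) ENNReal.coe_ne_top]
  simp

theorem tame_condLeaf (y : X) : Tame (condLeaf μ y) := tame_of_wMass_eq_one (wMass_condLeaf μ y)

theorem lintegral_shearMeasure_eq_condLeaf {g : X × ℝ → ℝ≥0∞} (hg : Measurable g) :
    ∫⁻ q, g q ∂(shearMeasure μ) =
      ∫⁻ y, ∫⁻ s, g (y, s) ∂(condLeaf μ y) ∂(antiConv cauchyWeight μ) := by
  have h1 : ∫⁻ q, g q ∂(shearMeasure μ) =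
      ∫⁻ q, (cauchyWeight q.2 : ℝ≥0∞)⁻¹ * g q ∂(cauchyShear μ) := by
    rw [cauchyShear, lintegral_withDensity_eq_lintegral_mul _ (by fun_prop) (by fun_prop)]
    refine lintegral_congr fun q => ?_
    rw [Pi.mul_apply, ← mul_assoc,
      ENNReal.mul_inv_cancel (cauchyWeight_ne_zero _) ENNReal.coe_ne_top, one_mul]
  rw [h1, ← Measure.lintegral_condKernel (by fun_prop), cauchyShear_fst]
  exact lintegral_congr fun y => (lintegral_condLeaf μ (by fun_prop) y).symm

/-- Uniqueness of the disintegration of `shearMeasure μ`. -/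
theorem smul_ae_eq_condLeaf {σ : X → Measure ℝ} (hσ : Measurable σ) {h : X → ℝ≥0∞}
    (hh : Measurable h)
    (H : ∀ g : X × ℝ → ℝ≥0∞, Measurable g → ∫⁻ q, g q ∂(shearMeasure μ) =
      ∫⁻ y, h y * ∫⁻ s, g (y, s) ∂(σ y) ∂(antiConv cauchyWeight μ)) :
    ∀ᵐ y ∂(antiConv cauchyWeight μ), h y • σ y = condLeaf μ y := by
  set η : X → Measure ℝ := fun y => (h y • σ y).withDensity fun s => (cauchyWeight s : ℝ≥0∞)
    with hη
  have hηE : ∀ y, ∀ E, MeasurableSet E →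
      η y E = h y * ∫⁻ s, E.indicator (fun s => (cauchyWeight s : ℝ≥0∞)) s ∂(σ y) := by
    intro y E hE
    rw [hη, withDensity_apply _ hE, ← lintegral_indicator hE, lintegral_smul_measure, smul_eq_mul]
  have hηm : Measurable η := by
    refine Measure.measurable_of_measurable_coe _ fun E hE => ?_
    simp_rw [hηE _ E hE]
    exact hh.mul ((Measure.measurable_lintegral
      ((by fun_prop : Measurable fun s => (cauchyWeight s : ℝ≥0∞)).indicator hE)).comp hσ)
  -- Testing `H` on the Cauchy density times an indicator in `y` shows that `η y` is a probability
  -- measure almost everywhere.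
  have htot : ∀ᵐ y ∂(antiConv cauchyWeight μ), η y univ = 1 := by
    refine ae_eq_of_forall_setLIntegral_eq_of_sigmaFinite
      ((Measure.measurable_coe MeasurableSet.univ).comp hηm) measurable_const fun E hE _ => ?_
    have hg : Measurable fun q : X × ℝ =>
        (cauchyWeight q.2 : ℝ≥0∞) * E.indicator (1 : X → ℝ≥0∞) q.1 :=
      (by fun_prop : Measurable fun q : X × ℝ => (cauchyWeight q.2 : ℝ≥0∞)).mul
        ((measurable_one.indicator hE).comp measurable_fst)
    rw [setLIntegral_one, ← lintegral_indicator_one hE,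
      lintegral_antiConv μ measurable_cauchyWeight (measurable_one.indicator hE), H _ hg,
      ← lintegral_indicator hE]
    refine lintegral_congr fun y => ?_
    by_cases hy : y ∈ E
    · simp [hy, hηE y univ MeasurableSet.univ]
    · simp [hy]
  -- The value `dirac 0` on the null set makes `κ` Markov at every point, so that uniqueness of
  -- conditional kernels applies.
  let κ : Kernel X ℝ := ⟨fun y => if η y univ = 1 then η y else Measure.dirac 0,
    Measurable.ite (((Measure.measurable_coe MeasurableSet.univ).comp hηm)
      (measurableSet_singleton 1)) hηm measurable_const⟩
  have hκ : ∀ᵐ y ∂(antiConv cauchyWeight μ), κ y = η y := by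
    filter_upwards [htot] with y hy
    exact if_pos hy
  have : IsMarkovKernel κ := by
    refine ⟨fun y => ?_⟩
    change IsProbabilityMeasure (if η y univ = 1 then η y else Measure.dirac 0)
    split_ifs with hy
    · exact ⟨hy⟩
    · infer_instance
  have hdis : cauchyShear μ = (cauchyShear μ).fst ⊗ₘ κ := by
    ext S hS
    have hg : Measurable fun q : X × ℝ => S.indicator (fun q => (cauchyWeight q.2 : ℝ≥0∞)) q :=
      (by fun_prop : Measurable fun q : X × ℝ => (cauchyWeight q.2 : ℝ≥0∞)).indicator hS
    rw [Measure.compProd_apply hS, cauchyShear_fst, cauchyShear, withDensity_apply _ hS,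
      ← lintegral_indicator hS, H _ hg]
    refine lintegral_congr_ae ?_
    filter_upwards [hκ] with y hy
    rw [hy, hηE y _ (measurable_prodMk_left hS)]
    rfl
  have huniq := eq_condKernel_of_measure_eq_compProd κ hdis
  rw [cauchyShear_fst] at huniq
  filter_upwards [huniq, hκ] with y h1 h2
  rw [condLeaf, ← h1, h2, hη]
  exact (withDensity_inv_same (by fun_prop)
    (Eventually.of_forall fun s => cauchyWeight_ne_zero s)
    (Eventually.of_forall fun s => ENNReal.coe_ne_top)).symm

theorem measurable_lintegral_condLeaf_const {f : ℝ → ℝ≥0∞} (hf : Measurable f) :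
    Measurable fun y => ∫⁻ s, f s ∂(condLeaf μ y) :=
  (Measure.measurable_lintegral hf).comp (measurable_condLeaf μ)

/-- Every `S_f μ` is thereby absolutely continuous with respect to the Cauchy version, so
exceptional sets need be controlled for that single measure only. -/
theorem antiConv_eq_withDensity {f : ℝ → ℝ≥0} (hf : Measurable f) :
    antiConv f μ =
      (antiConv cauchyWeight μ).withDensity fun y => ∫⁻ s, f s ∂(condLeaf μ y) := by
  ext S hS
  have hi : Measurable (S.indicator (1 : X → ℝ≥0∞)) := measurable_one.indicator hS
  rw [← lintegral_indicator_one hS, lintegral_antiConv μ hf hi,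
    lintegral_shearMeasure_eq_condLeaf μ (by fun_prop), withDensity_apply _ hS,
    ← lintegral_indicator hS]
  refine lintegral_congr fun y => ?_
  dsimp only
  rw [lintegral_mul_const _ (by fun_prop)]
  by_cases hy : y ∈ S <;> simp [hy]

theorem ae_antiConv_iff {f : ℝ → ℝ≥0} (hf : Measurable f) {Q : X → Prop} :
    (∀ᵐ y ∂(antiConv f μ), Q y) ↔
      ∀ᵐ y ∂(antiConv cauchyWeight μ), ∫⁻ s, f s ∂(condLeaf μ y) ≠ 0 → Q y := by
  rw [antiConv_eq_withDensity μ hf]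
  exact ae_withDensity_iff (measurable_lintegral_condLeaf_const μ (by fun_prop))

theorem ae_antiConv_of_ae {f : ℝ → ℝ≥0} (hf : Measurable f) {Q : X → Prop}
    (h : ∀ᵐ y ∂(antiConv cauchyWeight μ), Q y) : ∀ᵐ y ∂(antiConv f μ), Q y :=
  (ae_antiConv_iff μ hf).2 (h.mono fun _ hy _ => hy)

theorem lintegral_condLeaf_lt_top_ae {f : ℝ → ℝ≥0} (hf : Measurable f) (h1 : ∫⁻ s, f s = 1) :
    ∀ᵐ y ∂(antiConv cauchyWeight μ), ∫⁻ s, f s ∂(condLeaf μ y) < ∞ := by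
  have := isProbabilityMeasure_antiConv μ hf h1
  refine ae_lt_top (measurable_lintegral_condLeaf_const μ (by fun_prop)) ?_
  rw [← setLIntegral_univ, ← withDensity_apply _ MeasurableSet.univ,
    ← antiConv_eq_withDensity μ hf]
  simp

/-- Almost everywhere with respect to `antiConv cauchyWeight μ` implies almost everywhere along
`u`-orbits of `μ`-almost every point. -/
theorem ae_ae_of_ae_antiConv {Q : X → Prop} (h : ∀ᵐ y ∂(antiConv cauchyWeight μ), Q y) :
    ∀ᵐ x ∂μ, ∀ᵐ s : ℝ, Q (uB (-s) • x) := by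
  obtain ⟨S, hQS, hS, hS0⟩ := exists_measurable_superset_of_null (ae_iff.1 h)
  have hi : Measurable (S.indicator (1 : X → ℝ≥0∞)) := measurable_one.indicator hS
  rw [← lintegral_indicator_one hS, lintegral_antiConv μ measurable_cauchyWeight hi,
    lintegral_shearMeasure μ (by fun_prop), lintegral_eq_zero_iff (Measurable.lintegral_prod_right'
      (f := fun q : X × ℝ => (cauchyWeight q.2 : ℝ≥0∞) * S.indicator 1 (uB (-q.2) • q.1))
      ((by fun_prop : Measurable fun q : X × ℝ => (cauchyWeight q.2 : ℝ≥0∞)).mul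
        (hi.comp (by fun_prop))))] at hS0
  filter_upwards [hS0] with x hx
  rw [Pi.zero_apply, lintegral_eq_zero_iff
    (f := fun s : ℝ => (cauchyWeight s : ℝ≥0∞) * S.indicator 1 (uB (-s) • x)) ((by fun_prop : Measurable fun s : ℝ => (cauchyWeight s : ℝ≥0∞)).mul
        (hi.comp (by fun_prop)))] at hx
  filter_upwards [hx] with s hs
  by_contra hc
  have hm : uB (-s) • x ∈ S := hQS hc
  simp [hm, (cauchyWeight_pos s).ne'] at hs

/-- The effect on the leafwise measures of a transformation which rescales `shearMeasure μ`. -/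
theorem condLeaf_eq_wNormalize_map {θ θ' : X → X} (hθ : Measurable θ) (hθ' : Measurable θ')
    (hinv : ∀ x, θ' (θ x) = x) {b c b' c' : ℝ} (hb : ∀ s, aff b' c' (aff b c s) = s)
    {C : ℝ≥0∞} (hC0 : C ≠ 0) (hCt : C ≠ ∞)
    (H : ∀ g : X × ℝ → ℝ≥0∞, Measurable g → ∫⁻ q, g (θ q.1, aff b c q.2) ∂(shearMeasure μ) =
      C * ∫⁻ q, g q ∂(shearMeasure μ)) :
    (∀ᵐ y ∂(antiConv cauchyWeight μ),
      condLeaf μ y = wNormalize ((condLeaf μ (θ' y)).map (aff b c))) ∧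
    ∀ Q : X → Prop, (∀ᵐ y ∂(antiConv cauchyWeight μ), Q y) →
      ∀ᵐ y ∂(antiConv cauchyWeight μ), Q (θ y) := by
  set h : X → ℝ≥0∞ := fun y => ∫⁻ s, cauchyWeight (aff b' c' s) ∂(condLeaf μ y) with hh
  have hhm : Measurable h := measurable_lintegral_condLeaf_const μ
    (f := fun s => (cauchyWeight (aff b' c' s) : ℝ≥0∞)) (by fun_prop)
  -- The image of `antiConv cauchyWeight μ` under `θ` has density `C * h`: test `H` with the Cauchy
  -- weight pulled back by the inverse affine map, so that the two maps cancel.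
  have key : ∀ F : X → ℝ≥0∞, Measurable F → ∫⁻ y, F (θ y) ∂(antiConv cauchyWeight μ) =
      C * ∫⁻ y, h y * F y ∂(antiConv cauchyWeight μ) := by
    intro F hF
    have h1 := H (fun q => cauchyWeight (aff b' c' q.2) * F q.1) (by fun_prop)
    simp only [hb] at h1
    rw [lintegral_antiConv μ measurable_cauchyWeight (h := fun y => F (θ y)) (by fun_prop), h1,
      lintegral_shearMeasure_eq_condLeaf μ (by fun_prop)]
    congr 1
    refine lintegral_congr fun y => ?_
    dsimp only
    rw [lintegral_mul_const _ (by fun_prop)]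
  have hmapm : Measurable fun y => (condLeaf μ (θ' y)).map (aff b c) :=
    measurable_map_aff_condLeaf μ hθ' measurable_const measurable_const
  constructor
  · have := smul_ae_eq_condLeaf μ hmapm hhm fun g hg => ?_
    · filter_upwards [this] with y hy
      rw [← hy]
      exact smul_eq_wNormalize (by rw [hy, wMass_condLeaf])
    · have hF : ∀ y, ∫⁻ s, g (y, s) ∂((condLeaf μ (θ' y)).map (aff b c)) =
          ∫⁻ s, g (y, aff b c s) ∂(condLeaf μ (θ' y)) := fun y =>
        lintegral_map (by fun_prop) (by fun_prop)
      have hFm : Measurable fun y => ∫⁻ s, g (y, s) ∂((condLeaf μ (θ' y)).map (aff b c)) := by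
        simp_rw [hF]
        exact measurable_lintegral_condLeaf μ hθ' (g := fun q : X × ℝ => g (q.1, aff b c q.2))
          (by fun_prop)
      have h2 := key _ hFm
      have h3 : ∫⁻ q, g (θ q.1, aff b c q.2) ∂(shearMeasure μ) =
          ∫⁻ y, ∫⁻ s, g (θ y, s) ∂((condLeaf μ (θ' (θ y))).map (aff b c))
            ∂(antiConv cauchyWeight μ) := by
        rw [lintegral_shearMeasure_eq_condLeaf μ (by fun_prop)]
        refine lintegral_congr fun y => ?_
        rw [hF, hinv]
      rw [H g hg, h2] at h3
      exact (ENNReal.mul_right_inj hC0 hCt).1 h3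
  · intro Q hQ
    obtain ⟨S, hQS, hS, hS0⟩ := exists_measurable_superset_of_null (ae_iff.1 hQ)
    have hi : Measurable (S.indicator (1 : X → ℝ≥0∞)) := measurable_one.indicator hS
    have h1 := key _ hi
    have h2 : ∫⁻ y, h y * S.indicator 1 y ∂(antiConv cauchyWeight μ) = 0 := by
      rw [lintegral_eq_zero_iff (by fun_prop)]
      have : ∀ᵐ y ∂(antiConv cauchyWeight μ), y ∉ S := by
        rw [ae_iff]; simpa using hS0
      filter_upwards [this] with y hy
      simp [hy]
    rw [h2, mul_zero, lintegral_eq_zero_iff (by fun_prop)] at h1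
    filter_upwards [h1] with y hy
    by_contra hc
    have : θ y ∈ S := hQS hc
    simp [this] at hy

theorem condLeaf_uB (t : ℝ) : ∀ᵐ y ∂(antiConv cauchyWeight μ),
    condLeaf μ y = wNormalize ((condLeaf μ (uB t • y)).map (aff 1 t)) := by
  refine (condLeaf_eq_wNormalize_map μ (θ := fun y => uB (-t) • y) (θ' := fun y => uB t • y)
    (by fun_prop) (by fun_prop) (fun x => by simp [uB_smul_uB_smul]) (b' := 1) (c' := -t)
    (fun s => by simp [aff]) one_ne_zero ENNReal.one_ne_top fun g hg => ?_).1
  rw [one_mul, ← lintegral_shearMeasure_uB μ (-t) hg]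
  simp [aff]

theorem condLeaf_aB [SMulInvariantMeasure aSubgroup X μ] (t : ℝ) :
    (∀ᵐ y ∂(antiConv cauchyWeight μ),
      condLeaf μ y = wNormalize ((condLeaf μ (aB (-t) • y)).map (aff (Real.exp t) 0))) ∧
    ∀ Q : X → Prop, (∀ᵐ y ∂(antiConv cauchyWeight μ), Q y) →
      ∀ᵐ y ∂(antiConv cauchyWeight μ), Q (aB t • y) := by
  refine condLeaf_eq_wNormalize_map μ (θ := fun y => aB t • y) (θ' := fun y => aB (-t) • y)
    (by fun_prop) (by fun_prop) (fun x => by simp [aB_smul_aB_smul]) (b' := Real.exp (-t))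
    (c' := 0) (fun s => by rw [aff, aff, add_zero, add_zero, ← mul_assoc, ← Real.exp_add]; simp)
    (C := ENNReal.ofReal (Real.exp (-t))) (by simp [Real.exp_pos]) ENNReal.ofReal_ne_top
    fun g hg => ?_
  rw [← lintegral_shearMeasure_aB μ t hg]
  simp [aff]

end BaseSystem

/-! ### Existence of an exactly equivariant system -/

section Existence

variable {X : Type*} [TopologicalSpace X] [SecondCountableTopology X] [MeasurableSpace X]
  [BorelSpace X] [MulAction BGroup X] [ContinuousSMul BGroup X]
  (μ : Measure X) [IsProbabilityMeasure μ]

/-- The mass and disintegration axioms see `σ` only up to null sets of the Cauchy version, so only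
equivariance must hold everywhere. -/
theorem isLeafwiseSystem_of_ae_eq_condLeaf {σ : X → Measure ℝ} (hm : Measurable σ)
    (hlf : ∀ y, IsLocallyFiniteMeasure (σ y))
    (heq : ∀ (s : ℝ) (y : X), MeasProp (σ (uB s • y)) ((σ y).map fun r => r - s))
    (hσ : ∀ᵐ y ∂(antiConv cauchyWeight μ), σ y = condLeaf μ y) : IsLeafwiseSystem μ σ where
  measurable := hm
  locallyFinite := hlf
  equivariant := heq
  mass f hf h1 := by
    rw [ae_antiConv_iff μ hf]
    filter_upwards [hσ, lintegral_condLeaf_lt_top_ae μ hf h1] with y hy hy' h0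
    rw [hy]
    exact ⟨pos_iff_ne_zero.2 h0, hy'⟩
  disintegration f hf h1 g hg := by
    have hI : ∀ᵐ y ∂(antiConv f μ),
        (∫⁻ s, f s ∂(σ y))⁻¹ * ∫⁻ s, g (y, s) * f s ∂(σ y) =
        (∫⁻ s, f s ∂(condLeaf μ y))⁻¹ * ∫⁻ s, g (y, s) * f s ∂(condLeaf μ y) := by
      filter_upwards [ae_antiConv_of_ae μ hf hσ] with y hy
      rw [hy]
    have hm1 := measurable_lintegral_condLeaf_const μ (f := fun s => (f s : ℝ≥0∞)) (by fun_prop)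
    have hm2 := measurable_lintegral_condLeaf μ measurable_id
      (g := fun q : X × ℝ => g q * f q.2) (by fun_prop)
    rw [lintegral_congr_ae hI, antiConv_eq_withDensity μ hf,
      lintegral_withDensity_eq_lintegral_mul _ hm1
        (g := fun y => (∫⁻ s, f s ∂(condLeaf μ y))⁻¹ * ∫⁻ s, g (y, s) * f s ∂(condLeaf μ y))
        (hm1.inv.mul hm2),
      lintegral_shearMeasure_eq_condLeaf μ (by fun_prop)]
    refine lintegral_congr_ae ?_
    filter_upwards [lintegral_condLeaf_lt_top_ae μ hf h1] with y hy
    simp only [Pi.mul_apply, mul_comm (f _ : ℝ≥0∞)]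
    -- Where the normalising mass vanishes, its inverse is `∞`, but the density `0` multiplies it;
    -- the other side vanishes because `f = 0` almost everywhere.
    by_cases h0 : ∫⁻ s, f s ∂(condLeaf μ y) = 0
    · rw [h0, zero_mul]
      rw [lintegral_eq_zero_iff (by fun_prop)] at h0 ⊢
      filter_upwards [h0] with s hs
      rw [hs]; simp
    · rw [← mul_assoc, ENNReal.mul_inv_cancel h0 hy.ne, one_mul]

theorem measurableSet_eq_measure {Y : Type*} [MeasurableSpace Y] {Φ Ψ : Y → Measure ℝ}
    (hΦ : ∀ y, IsLocallyFiniteMeasure (Φ y)) (hΦm : Measurable Φ) (hΨm : Measurable Ψ) :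
    MeasurableSet {y | Φ y = Ψ y} := by
  have : {y | Φ y = Ψ y} =
      ⋂ (a : ℚ) (b : ℚ), {y | Φ y (Ioo (a : ℝ) b) = Ψ y (Ioo (a : ℝ) b)} := by
    ext y
    simp only [mem_iInter, mem_ofPred_eq]
    refine ⟨fun h a b => by rw [h], fun h => ?_⟩
    have := hΦ y
    exact Real.measure_ext_Ioo_rat h
  rw [this]
  refine MeasurableSet.iInter fun a => MeasurableSet.iInter fun b => ?_
  exact measurableSet_eq_fun ((Measure.measurable_coe measurableSet_Ioo).comp hΦm)
    ((Measure.measurable_coe measurableSet_Ioo).comp hΨm)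

theorem measurable_wNormalize : Measurable wNormalize := by
  refine Measure.measurable_of_measurable_coe _ fun E hE => ?_
  exact measurable_wMass.inv.mul (Measure.measurable_coe hE)

/-- The Cauchy distribution. -/
noncomputable def cauchyProb : Measure ℝ :=
  (volume : Measure ℝ).withDensity fun s => (cauchyWeight s : ℝ≥0∞)

instance : IsProbabilityMeasure cauchyProb :=
  ⟨by rw [cauchyProb, withDensity_apply _ MeasurableSet.univ, setLIntegral_univ,
    lintegral_cauchyWeight]⟩

theorem ae_cauchyProb_iff {Q : ℝ → Prop} : (∀ᵐ s ∂cauchyProb, Q s) ↔ ∀ᵐ s, Q s := by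
  rw [cauchyProb, ae_withDensity_iff (by fun_prop)]
  simp [(cauchyWeight_pos _).ne']

/-- The prediction for the leafwise measure at `y` from the one at `u(t) y`. -/
noncomputable def leafFrom (y : X) (t : ℝ) : Measure ℝ :=
  wNormalize ((condLeaf μ (uB t • y)).map (aff 1 t))

/-- The average over `t` of the predictions from `u(t) y`. -/
noncomputable def meanLeaf (y : X) : Measure ℝ := cauchyProb.bind (leafFrom μ y)

/-- The points at which almost all predictions agree. -/
def consistentSet : Set X := {y | ∀ᵐ t : ℝ, leafFrom μ y t = meanLeaf μ y}

open Classical in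
/-- The exactly `u`-equivariant system of leafwise measures. -/
noncomputable def leaf (y : X) : Measure ℝ := if y ∈ consistentSet μ then meanLeaf μ y else 0

theorem measurable_leafFrom_uncurry : Measurable fun q : X × ℝ => leafFrom μ q.1 q.2 :=
  measurable_wNormalize.comp
    (measurable_map_aff_condLeaf μ (θ := fun q : X × ℝ => uB q.2 • q.1) (by fun_prop)
      measurable_const measurable_snd)

theorem measurable_leafFrom (y : X) : Measurable (leafFrom μ y) :=
  measurable_wNormalize.comp
    (measurable_map_aff_condLeaf μ (θ := fun t => uB t • y) (by fun_prop)
      measurable_const measurable_id)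

theorem tame_leafFrom (y : X) (t : ℝ) : Tame (leafFrom μ y t) := by
  have h := (tame_condLeaf μ (uB t • y)).map_aff one_ne_zero t
  exact h.measProp_wNormalize.tame h

theorem measurable_meanLeaf : Measurable (meanLeaf μ) := by
  refine Measure.measurable_of_measurable_coe _ fun E hE => ?_
  have h : ∀ y, meanLeaf μ y E = ∫⁻ t, leafFrom μ y t E ∂cauchyProb := fun y =>
    Measure.bind_apply hE (measurable_leafFrom μ y).aemeasurable
  simp_rw [h]
  exact Measurable.lintegral_prod_right' (f := fun q : X × ℝ => leafFrom μ q.1 q.2 E)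
    ((Measure.measurable_coe hE).comp (measurable_leafFrom_uncurry μ))

theorem measurableSet_consistentSet : MeasurableSet (consistentSet μ) := by
  set S : Set (X × ℝ) := {q | leafFrom μ q.1 q.2 = meanLeaf μ q.1} with hS
  have hSm : MeasurableSet S := measurableSet_eq_measure
    (fun q => (tame_leafFrom μ q.1 q.2).locallyFinite) (measurable_leafFrom_uncurry μ)
    ((measurable_meanLeaf μ).comp measurable_fst)
  exact (measurable_measure_prodMk_left (ν := (volume : Measure ℝ)) hSm.compl)
    (measurableSet_singleton 0)

theorem meanLeaf_eq_of_ae {y : X} {ν : Measure ℝ} (h : ∀ᵐ t : ℝ, leafFrom μ y t = ν) :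
    meanLeaf μ y = ν := by
  have h' : leafFrom μ y =ᵐ[cauchyProb] fun _ => ν := ae_cauchyProb_iff.2 h
  rw [meanLeaf, Measure.bind_congr_right h', Measure.bind_const]
  simp

/-- Both predictions look at the same point `u(t + s)y`; they differ only in the origin of the line.
-/
theorem leafFrom_uB_smul (s t : ℝ) (y : X) :
    leafFrom μ (uB s • y) t = wNormalize ((leafFrom μ y (t + s)).map (aff 1 (-s))) := by
  have h := ((tame_condLeaf μ (uB (t + s) • y)).map_aff one_ne_zero (t + s)).measProp_wNormalize
  rw [leafFrom, leafFrom, (h.map (aff 1 (-s))).wNormalize_eq, map_aff_map_aff, uB_smul_uB_smul]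
  simp

theorem leafFrom_uB_smul_ae {y : X} (hy : y ∈ consistentSet μ) (s : ℝ) :
    ∀ᵐ t : ℝ, leafFrom μ (uB s • y) t = wNormalize ((meanLeaf μ y).map (aff 1 (-s))) := by
  have h := (measurePreserving_add_right (volume : Measure ℝ) s).quasiMeasurePreserving.ae hy
  filter_upwards [h] with t ht
  rw [leafFrom_uB_smul, ht]

theorem uB_smul_mem_consistentSet {y : X} (hy : y ∈ consistentSet μ) (s : ℝ) :
    uB s • y ∈ consistentSet μ := by
  have h := leafFrom_uB_smul_ae μ hy s
  rw [← meanLeaf_eq_of_ae μ h] at h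
  exact h

theorem uB_smul_mem_consistentSet_iff {y : X} (s : ℝ) :
    uB s • y ∈ consistentSet μ ↔ y ∈ consistentSet μ := by
  refine ⟨fun h => ?_, fun h => uB_smul_mem_consistentSet μ h s⟩
  have := uB_smul_mem_consistentSet μ h (-s)
  rwa [uB_smul_uB_smul, neg_add_cancel, uB_zero_smul] at this

theorem tame_meanLeaf {y : X} (hy : y ∈ consistentSet μ) : Tame (meanLeaf μ y) := by
  obtain ⟨t, ht⟩ := Eventually.exists (f := ae (volume : Measure ℝ)) hy
  rw [← ht]
  exact tame_leafFrom μ y t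

/-- For each `t` the prediction is right at almost every `y`; Fubini turns this into: at almost
every `y` it is right for almost every `t`. Measurability of the set of agreement is what permits
the exchange. -/
theorem leaf_ae_eq : ∀ᵐ y ∂(antiConv cauchyWeight μ),
    leaf μ y = condLeaf μ y := by
  have hm : MeasurableSet {q : X × ℝ | leafFrom μ q.1 q.2 = condLeaf μ q.1} :=
    measurableSet_eq_measure (fun q => (tame_leafFrom μ q.1 q.2).locallyFinite)
      (measurable_leafFrom_uncurry μ) ((measurable_condLeaf μ).comp measurable_fst)
  have h : ∀ᵐ y ∂(antiConv cauchyWeight μ), ∀ᵐ t ∂cauchyProb, leafFrom μ y t = condLeaf μ y := by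
    refine (Measure.ae_ae_comm (p := fun t y => leafFrom μ y t = condLeaf μ y) ?_).1
      (Eventually.of_forall fun t => ?_)
    · exact measurable_swap hm
    · filter_upwards [condLeaf_uB μ t] with y hy
      exact hy.symm
  filter_upwards [h] with y hy
  rw [ae_cauchyProb_iff] at hy
  have h1 := meanLeaf_eq_of_ae μ hy
  rw [← h1] at hy
  rw [leaf, if_pos (show y ∈ consistentSet μ from hy), h1]

theorem isLeafwiseSystem_leaf : IsLeafwiseSystem μ (leaf μ) := by
  refine isLeafwiseSystem_of_ae_eq_condLeaf μ ?_ (fun y => ?_) (fun s y => ?_) (leaf_ae_eq μ)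
  · exact Measurable.ite (measurableSet_consistentSet μ) (measurable_meanLeaf μ) measurable_const
  · by_cases hy : y ∈ consistentSet μ
    · rw [leaf, if_pos hy]
      exact (tame_meanLeaf μ hy).locallyFinite
    · rw [leaf, if_neg hy]
      infer_instance
  · rw [sub_eq_aff]
    by_cases hy : y ∈ consistentSet μ
    · rw [leaf, leaf, if_pos hy, if_pos ((uB_smul_mem_consistentSet_iff μ s).2 hy),
        meanLeaf_eq_of_ae μ (leafFrom_uB_smul_ae μ hy s)]
      exact ((tame_meanLeaf μ hy).map_aff one_ne_zero _).measProp_wNormalize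
    -- The consistent set is `u`-invariant, so off it both measures are zero.
    · rw [leaf, leaf, if_neg hy, if_neg (mt (uB_smul_mem_consistentSet_iff μ s).1 hy),
        Measure.map_zero]
      exact MeasProp.refl 0

end Existence

/-! ### Uniqueness of leafwise systems and their behaviour under `a(t)` -/

namespace IsLeafwiseSystem

variable {X : Type*} [TopologicalSpace X] [SecondCountableTopology X] [MeasurableSpace X]
  [BorelSpace X] [MulAction BGroup X] [ContinuousSMul BGroup X]
  {μ : Measure X} [IsProbabilityMeasure μ] {σ : X → Measure ℝ}

theorem measProp_condLeaf (hσ : IsLeafwiseSystem μ σ) :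
    ∀ᵐ y ∂(antiConv cauchyWeight μ), MeasProp (σ y) (condLeaf μ y) := by
  have hh : Measurable fun y => (wMass (σ y))⁻¹ := (measurable_wMass.comp hσ.measurable).inv
  have h := smul_ae_eq_condLeaf μ hσ.measurable hh fun g hg => ?_
  · filter_upwards [h, hσ.mass _ measurable_cauchyWeight lintegral_cauchyWeight] with y h1 h2
    rw [← h1]
    exact (measProp_smul (ENNReal.inv_ne_zero.2 h2.2.ne) (ENNReal.inv_ne_top.2 h2.1.ne') _).symm
  · have h1 := hσ.disintegration _ measurable_cauchyWeight lintegral_cauchyWeight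
      (fun q => (cauchyWeight q.2 : ℝ≥0∞)⁻¹ * g q) (by fun_prop)
    have h2 : ∀ r : ℝ, ∀ a : ℝ≥0∞,
        (cauchyWeight r : ℝ≥0∞) * ((cauchyWeight r : ℝ≥0∞)⁻¹ * a) = a := fun r a => by
      rw [← mul_assoc, ENNReal.mul_inv_cancel (cauchyWeight_ne_zero _) ENNReal.coe_ne_top, one_mul]
    simp only [h2, mul_comm _ (cauchyWeight _ : ℝ≥0∞)] at h1
    exact h1

theorem uB_smul (hσ : IsLeafwiseSystem μ σ) (s : ℝ) (y : X) :
    MeasProp (σ (uB s • y)) ((σ y).map (aff 1 (-s))) := by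
  rw [← sub_eq_aff]
  exact hσ.equivariant s y

/-- Uniqueness gives the relation only almost everywhere for `S_f μ`, to which `μ` need not be
absolutely continuous. But `μ`-almost every `x` has a good point `y = u(-s)x` on its orbit, and the
exact `u`-equivariance carries the relation from `y` back to `x`. -/
theorem aB_smul [SMulInvariantMeasure aSubgroup X μ] (hσ : IsLeafwiseSystem μ σ) (t : ℝ) :
    ∀ᵐ x ∂μ, MeasProp (σ (aB t • x)) ((σ x).map (aff (Real.exp t) 0)) := by
  have h1 := hσ.measProp_condLeaf
  have h2 := (condLeaf_aB μ (-t)).2 _ h1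
  have h3 := (condLeaf_aB μ t).1
  have h4 : ∀ᵐ x ∂μ, MeasProp (σ x) ((σ (aB (-t) • x)).map (aff (Real.exp t) 0)) := by
    filter_upwards [ae_ae_of_ae_antiConv μ h1, ae_ae_of_ae_antiConv μ h2,
      ae_ae_of_ae_antiConv μ h3] with x e1 e2 e3
    obtain ⟨s, f1, f2, f3⟩ := (e1.and (e2.and e3)).exists
    set y := uB (-s) • x with hy
    have hxy : x = uB s • y := by rw [hy, uB_smul_uB_smul]; simp
    have g1 : MeasProp (σ x) ((σ y).map (aff 1 (-s))) := by
      nth_rewrite 1 [hxy]; exact hσ.uB_smul s y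
    have g2 : MeasProp (σ y) ((σ (aB (-t) • y)).map (aff (Real.exp t) 0)) := by
      refine f1.trans ?_
      rw [f3]
      exact ((tame_condLeaf μ _).map_aff (Real.exp_pos t).ne' 0).measProp_wNormalize.trans
        (f2.symm.map _)
    have g3 : MeasProp (σ (aB (-t) • y))
        ((σ (aB (-t) • x)).map (aff 1 (Real.exp (-t) * s))) := by
      rw [hy, aB_smul_uB_smul]
      simpa using hσ.uB_smul (Real.exp (-t) * -s) (aB (-t) • x)
    have g4 := g1.trans ((g2.trans (g3.map _)).map _)
    rw [map_aff_map_aff, map_aff_map_aff] at g4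
    -- The translation from `x` to `y` and the dilated translation back cancel.
    have e : Real.exp t * (Real.exp (-t) * s) = s := by
      rw [← mul_assoc, ← Real.exp_add]; simp
    simpa [e] using g4
  have h5 := (measurePreserving_aB_smul μ t).quasiMeasurePreserving.ae h4
  filter_upwards [h5] with x hx
  simpa [aB_smul_aB_smul] using hx

theorem ae_antiConv_measProp (hσ : IsLeafwiseSystem μ σ) {f : ℝ → ℝ≥0} (hf : Measurable f) :
    ∀ᵐ y ∂(antiConv f μ), MeasProp (σ y) (condLeaf μ y) :=
  ae_antiConv_of_ae μ hf hσ.measProp_condLeaf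

end IsLeafwiseSystem

/-! ### The doubling map and interpolation from integer to real times -/

section Doubling

/-- The doubling map of the unit interval. -/
noncomputable def doubling (s : ℝ) : ℝ := Int.fract (2 * s)

@[fun_prop]
theorem measurable_doubling : Measurable doubling :=
  measurable_fract.comp (measurable_const_mul 2)

theorem doubling_of_lt {s : ℝ} (h0 : 0 ≤ s) (h1 : s < 1 / 2) : doubling s = 2 * s :=
  Int.fract_eq_self.2 ⟨by linarith, by linarith⟩

theorem doubling_of_le {s : ℝ} (h0 : 1 / 2 ≤ s) (h1 : s < 1) : doubling s = 2 * s - 1 := by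
  rw [doubling, Int.fract_eq_iff]
  exact ⟨by linarith, by linarith, 1, by simp⟩

theorem fract_two_pow_mul_fract (k : ℕ) (s : ℝ) :
    Int.fract ((2 : ℝ) ^ k * Int.fract s) = Int.fract ((2 : ℝ) ^ k * s) := by
  have : (2 : ℝ) ^ k * Int.fract s = 2 ^ k * s - ((2 ^ k * ⌊s⌋ : ℤ) : ℝ) := by
    rw [Int.fract]; push_cast; ring
  rw [this, Int.fract_sub_intCast]

theorem iterate_doubling {s : ℝ} (hs : s ∈ Ico (0 : ℝ) 1) (n : ℕ) :
    doubling^[n] s = Int.fract ((2 : ℝ) ^ n * s) := by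
  induction n with
  | zero => simpa using (Int.fract_eq_self.2 hs).symm
  | succ n ih =>
    rw [Function.iterate_succ_apply', ih, doubling]
    have := fract_two_pow_mul_fract 1 ((2 : ℝ) ^ n * s)
    rw [pow_one] at this
    rw [this]; congr 1; ring

theorem measurePreserving_doubling : MeasurePreserving doubling
    ((volume : Measure ℝ).restrict (Ico 0 1)) ((volume : Measure ℝ).restrict (Ico 0 1)) := by
  refine ⟨by fun_prop, ?_⟩
  ext E hE
  have hI : MeasurableSet (E ∩ Ico (0 : ℝ) 1) := hE.inter measurableSet_Ico
  rw [Measure.map_apply (by fun_prop) hE, Measure.restrict_apply (measurable_doubling hE),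
    Measure.restrict_apply hE]
  set A : Set ℝ := (fun s => 2 * s) ⁻¹' (E ∩ Ico 0 1) with hA
  set B : Set ℝ := (fun s => 2 * s) ⁻¹' ((fun s => s - 1) ⁻¹' (E ∩ Ico 0 1)) with hB
  have hAm : MeasurableSet A := measurable_const_mul 2 hI
  have hAB : doubling ⁻¹' E ∩ Ico 0 1 = A ∪ B := by
    ext s
    simp only [hA, hB, mem_inter_iff, mem_preimage, mem_union, mem_Ico]
    constructor
    · rintro ⟨h, h0, h1⟩
      rcases lt_or_ge s (1 / 2) with h2 | h2
      · left
        rw [doubling_of_lt h0 h2] at h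
        exact ⟨h, by linarith, by linarith⟩
      · right
        rw [doubling_of_le h2 h1] at h
        exact ⟨h, by linarith, by linarith⟩
    · rintro (⟨h, h0, h1⟩ | ⟨h, h0, h1⟩)
      · rw [doubling_of_lt (by linarith) (by linarith)]
        exact ⟨h, by linarith, by linarith⟩
      · rw [doubling_of_le (by linarith) (by linarith)]
        exact ⟨h, by linarith, by linarith⟩
  have hdisj : Disjoint A B := by
    rw [Set.disjoint_left]
    rintro s ⟨-, h0, h1⟩ ⟨-, h2, h3⟩
    dsimp only at h1 h2
    linarith
  have hvA : volume A = ENNReal.ofReal (1 / 2) * volume (E ∩ Ico (0 : ℝ) 1) := by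
    rw [hA, Real.volume_preimage_mul_left two_ne_zero]; norm_num
  have hvB : volume B = ENNReal.ofReal (1 / 2) * volume (E ∩ Ico (0 : ℝ) 1) := by
    rw [hB, Real.volume_preimage_mul_left two_ne_zero]
    have := (measurePreserving_sub_right (volume : Measure ℝ) 1).measure_preimage
      hI.nullMeasurableSet
    rw [this]; norm_num
  rw [hAB, measure_union' hdisj hAm, hvA, hvB, ← add_mul, ← ENNReal.ofReal_add (by norm_num)
    (by norm_num)]
  norm_num

/-- Almost every point of the unit interval is not exponentially close to the end points of its
dyadic intervals. -/
theorem ae_eventually_exp_le_fract {ε : ℝ} (hε : 0 < ε) :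
    ∀ᵐ s ∂((volume : Measure ℝ).restrict (Ico 0 1)), ∀ᶠ n : ℕ in atTop,
      Real.exp (-(n * ε)) ≤ Int.fract ((2 : ℝ) ^ n * s) ∧
        Real.exp (-(n * ε)) < 1 - Int.fract ((2 : ℝ) ^ n * s) := by
  -- The bad points at level `n` are those sent within `e^{-nε}` of `0` or `1` by the `n`-th
  -- iterate. Invariance of Lebesgue measure bounds their measure by `2e^{-nε}`, which is summable.
  let S : ℕ → Set ℝ := fun n => Ico 0 (Real.exp (-(n * ε))) ∪ Icc (1 - Real.exp (-(n * ε))) 1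
  have hS : ∀ n, MeasurableSet (S n) := fun n => measurableSet_Ico.union measurableSet_Icc
  have hle : ∀ n, ((volume : Measure ℝ).restrict (Ico 0 1)) (doubling^[n] ⁻¹' S n) ≤
      ENNReal.ofReal (2 * Real.exp (-ε) ^ n) := by
    intro n
    rw [(measurePreserving_doubling.iterate n).measure_preimage (hS n).nullMeasurableSet]
    refine (Measure.restrict_apply_le _ _).trans ((measure_union_le _ _).trans ?_)
    rw [Real.volume_Ico, Real.volume_Icc, ← ENNReal.ofReal_add (by simp [(Real.exp_pos _).le])
      (by simp [(Real.exp_pos _).le]), ← Real.exp_nat_mul]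
    refine le_of_eq (congrArg _ ?_)
    ring_nf
  have hsum : (∑' n, ((volume : Measure ℝ).restrict (Ico 0 1)) (doubling^[n] ⁻¹' S n)) ≠ ∞ := by
    have hs : Summable fun n : ℕ => 2 * Real.exp (-ε) ^ n :=
      (summable_geometric_of_lt_one (Real.exp_pos _).le
        (by simpa using hε)).mul_left _
    refine ne_top_of_le_ne_top ?_ (ENNReal.tsum_le_tsum hle)
    rw [← ENNReal.ofReal_tsum_of_nonneg (fun n => by positivity) hs]
    exact ENNReal.ofReal_ne_top
  filter_upwards [ae_eventually_notMem hsum, ae_restrict_mem measurableSet_Ico] with s hs hs01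
  filter_upwards [hs] with n hn
  rw [mem_preimage, iterate_doubling hs01] at hn
  simp only [S, mem_union, mem_Ico, mem_Icc, not_or, not_and, not_lt, not_le] at hn
  have h0 := Int.fract_nonneg ((2 : ℝ) ^ n * s)
  have h1 := Int.fract_lt_one ((2 : ℝ) ^ n * s)
  refine ⟨hn.1 h0, ?_⟩
  by_contra hc
  have := hn.2 (by linarith)
  linarith

theorem tendsto_natFloor_comp_div {K : ℕ → ℝ} {γ a : ℝ} (ha : 0 < a)
    (hK : Tendsto (fun n : ℕ => K n / n) atTop (𝓝 γ)) :
    Tendsto (fun t : ℝ => K ⌊a * t⌋₊ / t) atTop (𝓝 (γ * a)) := by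
  have h1 : Tendsto (fun t : ℝ => ⌊a * t⌋₊) atTop atTop :=
    tendsto_nat_floor_atTop.comp (tendsto_id.const_mul_atTop ha)
  refine ((hK.comp h1).mul (tendsto_nat_floor_mul_div_atTop ha.le)).congr' ?_
  filter_upwards [h1.eventually_ge_atTop 1] with t ht
  have : ((⌊a * t⌋₊ : ℕ) : ℝ) ≠ 0 := by positivity
  simp only [Function.comp]
  field_simp

theorem tendsto_natCeil_comp_div {K : ℕ → ℝ} {γ a : ℝ} (ha : 0 < a)
    (hK : Tendsto (fun n : ℕ => K n / n) atTop (𝓝 γ)) :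
    Tendsto (fun t : ℝ => K ⌈a * t⌉₊ / t) atTop (𝓝 (γ * a)) := by
  have h1 : Tendsto (fun t : ℝ => ⌈a * t⌉₊) atTop atTop :=
    tendsto_nat_ceil_atTop.comp (tendsto_id.const_mul_atTop ha)
  refine ((hK.comp h1).mul (tendsto_nat_ceil_mul_div_atTop ha.le)).congr' ?_
  filter_upwards [h1.eventually_ge_atTop 1] with t ht
  have : ((⌈a * t⌉₊ : ℕ) : ℝ) ≠ 0 := by positivity
  simp only [Function.comp]
  field_simp

/-- A monotone function squeezed by a sequence of linear growth has linear growth. -/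
theorem Monotone.tendsto_div_of_squeeze {L : ℝ → ℝ} (hL : Monotone L) {K : ℕ → ℝ} {γ ℓ : ℝ}
    (hℓ : 0 < ℓ) (hK : Tendsto (fun n : ℕ => K n / n) atTop (𝓝 γ))
    (hup : ∀ n : ℕ, L (n * ℓ) ≤ K n)
    (hlow : ∀ j : ℕ, ∀ᶠ n : ℕ in atTop, K n ≤ L (n * (ℓ + 1 / (j + 1)))) :
    Tendsto (fun t => L t / t) atTop (𝓝 (γ / ℓ)) := by
  rw [tendsto_order]
  constructor
  · intro a ha
    have h1 : Tendsto (fun j : ℕ => γ * (ℓ + 1 / ((j : ℝ) + 1))⁻¹) atTop (𝓝 (γ * (ℓ + 0)⁻¹)) :=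
      tendsto_const_nhds.mul ((tendsto_const_nhds.add tendsto_one_div_add_atTop_nhds_zero_nat).inv₀
        (by rw [add_zero]; exact hℓ.ne'))
    rw [add_zero, ← div_eq_mul_inv] at h1
    -- Take `j` so large that the slower rate `γ / (ℓ + 1/(j+1))` still exceeds `a`; rounding down
    -- then gives the lower bound, rounding up the upper one.
    obtain ⟨j, hj⟩ := (h1.eventually (lt_mem_nhds ha)).exists
    have hp : 0 < ℓ + 1 / ((j : ℝ) + 1) := by positivity
    have h2 := tendsto_natFloor_comp_div (inv_pos.2 hp) hK
    have h3 : Tendsto (fun t : ℝ => ⌊(ℓ + 1 / ((j : ℝ) + 1))⁻¹ * t⌋₊) atTop atTop :=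
      tendsto_nat_floor_atTop.comp (tendsto_id.const_mul_atTop (inv_pos.2 hp))
    filter_upwards [h2.eventually (lt_mem_nhds hj), h3.eventually (hlow j), eventually_gt_atTop 0]
      with t ht ht2 ht0
    refine ht.trans_le (div_le_div_of_nonneg_right (ht2.trans (hL ?_)) ht0.le)
    rw [← le_div_iff₀ hp]
    exact (Nat.floor_le (mul_nonneg (inv_pos.2 hp).le ht0.le)).trans_eq (inv_mul_eq_div _ _)
  · intro a ha
    have h2 := tendsto_natCeil_comp_div (inv_pos.2 hℓ) hK
    rw [← div_eq_mul_inv] at h2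
    filter_upwards [h2.eventually (gt_mem_nhds ha), eventually_gt_atTop 0] with t ht ht0
    refine lt_of_le_of_lt (div_le_div_of_nonneg_right ((hL ?_).trans (hup _)) ht0.le) ht
    rw [← div_le_iff₀ hℓ, div_eq_inv_mul]
    exact Nat.le_ceil _

end Doubling

/-! ### Branch probabilities, information and dyadic cells -/

section Cells

/-- The proportion of the mass of `[0, 1)` which lies in `[0, 1/2)`. -/
noncomputable def halfProb (ν : Measure ℝ) : ℝ := (ν (Ico 0 (1 / 2)) / ν (Ico 0 1)).toReal

/-- The probability of the branch of the doubling map that contains `s`. -/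
noncomputable def branchProb (p s : ℝ) : ℝ := if s < 1 / 2 then p else 1 - p

/-- The information `-log r` of an event of probability `r`. -/
noncomputable def info (r : ℝ) : ℝ≥0∞ := if r = 0 then ∞ else ENNReal.ofReal (-Real.log r)

/-- The mass of the dyadic interval of level `n` containing `s`, as seen from `s`. -/
noncomputable def cellMass (ν : Measure ℝ) (n : ℕ) (s : ℝ) : ℝ≥0∞ :=
  ν (Ico (-Int.fract ((2 : ℝ) ^ n * s) / 2 ^ n) ((1 - Int.fract ((2 : ℝ) ^ n * s)) / 2 ^ n))

theorem measurable_halfProb : Measurable halfProb :=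
  ((Measure.measurable_coe measurableSet_Ico).div
    (Measure.measurable_coe measurableSet_Ico)).ennreal_toReal

theorem measurable_branchProb : Measurable fun q : ℝ × ℝ => branchProb q.1 q.2 :=
  Measurable.ite (measurableSet_lt measurable_snd measurable_const) measurable_fst
    (measurable_const.sub measurable_fst)

theorem measurable_info : Measurable info :=
  Measurable.ite (measurableSet_singleton 0) measurable_const (by fun_prop)

theorem measure_Ico_half_div_le_one (ν : Measure ℝ) :
    ν (Ico 0 (1 / 2)) / ν (Ico 0 1) ≤ 1 := by
  refine ENNReal.div_le_of_le_mul ?_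
  rw [one_mul]
  exact measure_mono (Ico_subset_Ico_right (by norm_num))

theorem halfProb_mem_Icc (ν : Measure ℝ) : halfProb ν ∈ Icc (0 : ℝ) 1 := by
  refine ⟨ENNReal.toReal_nonneg, ?_⟩
  have := ENNReal.toReal_mono ENNReal.one_ne_top (measure_Ico_half_div_le_one ν)
  rwa [ENNReal.toReal_one] at this

theorem branchProb_mem_Icc {p : ℝ} (hp : p ∈ Icc (0 : ℝ) 1) (s : ℝ) :
    branchProb p s ∈ Icc (0 : ℝ) 1 := by
  unfold branchProb
  split_ifs
  · exact hp
  · exact ⟨by linarith [hp.2], by linarith [hp.1]⟩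

theorem MeasProp.halfProb_eq {ν₁ ν₂ : Measure ℝ} (h : MeasProp ν₁ ν₂) :
    halfProb ν₁ = halfProb ν₂ := by
  obtain ⟨c, hc, rfl⟩ := h
  rw [halfProb, halfProb]
  simp only [Measure.smul_apply, ENNReal.smul_def, smul_eq_mul]
  rw [ENNReal.mul_div_mul_left _ _ (by simpa using hc) ENNReal.coe_ne_top]

theorem lintegral_indicator_Ico_mul (ν : Measure ℝ) (g : ℝ → ℝ≥0∞) :
    ∫⁻ s, (((Ico (0 : ℝ) 1).indicator (1 : ℝ → ℝ≥0) s : ℝ≥0) : ℝ≥0∞) * g s ∂ν =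
      ∫⁻ s in Ico 0 1, g s ∂ν := by
  rw [← lintegral_indicator measurableSet_Ico]
  refine lintegral_congr fun s => ?_
  by_cases hs : s ∈ Ico (0 : ℝ) 1 <;> simp only [indicator_of_mem, indicator_of_notMem, hs,
    not_false_eq_true] <;> simp

theorem lintegral_indicator_Ico (ν : Measure ℝ) :
    ∫⁻ s, (((Ico (0 : ℝ) 1).indicator (1 : ℝ → ℝ≥0) s : ℝ≥0) : ℝ≥0∞) ∂ν = ν (Ico 0 1) := by
  simp

theorem measurable_indicator_Ico : Measurable ((Ico (0 : ℝ) 1).indicator (1 : ℝ → ℝ≥0)) :=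
  measurable_one.indicator measurableSet_Ico

theorem Ico_half_union : Ico (0 : ℝ) (1 / 2) ∪ Ico (1 / 2) 1 = Ico 0 1 :=
  Ico_union_Ico_eq_Ico (by norm_num) (by norm_num)

theorem Ico_half_disjoint : Disjoint (Ico (0 : ℝ) (1 / 2)) (Ico (1 / 2) 1) :=
  Ico_disjoint_Ico_same

theorem ofReal_halfProb (ν : Measure ℝ) :
    ENNReal.ofReal (halfProb ν) = ν (Ico 0 (1 / 2)) / ν (Ico 0 1) :=
  ENNReal.ofReal_toReal (ne_top_of_le_ne_top ENNReal.one_ne_top (measure_Ico_half_div_le_one ν))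

theorem ofReal_one_sub_halfProb {ν : Measure ℝ} (h0 : ν (Ico 0 1) ≠ 0) (ht : ν (Ico 0 1) ≠ ∞) :
    ENNReal.ofReal (1 - halfProb ν) = ν (Ico (1 / 2) 1) / ν (Ico 0 1) := by
  rw [ENNReal.ofReal_sub _ (halfProb_mem_Icc ν).1, ofReal_halfProb, ENNReal.ofReal_one]
  refine (ENNReal.eq_sub_of_add_eq ?_ ?_).symm
  · exact ne_top_of_le_ne_top ENNReal.one_ne_top (measure_Ico_half_div_le_one ν)
  · rw [add_comm, ← ENNReal.add_div, ← measure_union Ico_half_disjoint measurableSet_Ico,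
      Ico_half_union, ENNReal.div_self h0 ht]

theorem inv_mul_setLIntegral_branch {ν : Measure ℝ} (h0 : ν (Ico 0 1) ≠ 0)
    (ht : ν (Ico 0 1) ≠ ∞) (a b : ℝ≥0∞) :
    (ν (Ico 0 1))⁻¹ * ∫⁻ s in Ico 0 1, (if s < 1 / 2 then a else b) ∂ν =
      ENNReal.ofReal (halfProb ν) * a + ENNReal.ofReal (1 - halfProb ν) * b := by
  have h1 : ∫⁻ s in Ico 0 1, (if s < 1 / 2 then a else b) ∂ν =
      a * ν (Ico 0 (1 / 2)) + b * ν (Ico (1 / 2) 1) := by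
    rw [← Ico_half_union, lintegral_union measurableSet_Ico Ico_half_disjoint]
    congr 1
    · rw [← setLIntegral_const]
      exact setLIntegral_congr_fun measurableSet_Ico fun s hs => if_pos hs.2
    · rw [← setLIntegral_const]
      exact setLIntegral_congr_fun measurableSet_Ico fun s hs => if_neg (not_lt.2 hs.1)
  rw [h1, ofReal_halfProb, ofReal_one_sub_halfProb h0 ht, ENNReal.div_eq_inv_mul,
    ENNReal.div_eq_inv_mul]
  ring

/-- For `r = 0` the convention `0 * ∞ = 0` matches `0 log 0 = 0`. -/
theorem ofReal_mul_info {r : ℝ} (h0 : 0 ≤ r) :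
    ENNReal.ofReal r * info r = ENNReal.ofReal (Real.negMulLog r) := by
  unfold info
  split_ifs with h
  · simp [h]
  · rw [← ENNReal.ofReal_mul h0, Real.negMulLog]
    congr 1; ring

theorem ofReal_binEntropy {p : ℝ} (hp : p ∈ Icc (0 : ℝ) 1) :
    ENNReal.ofReal p * info p + ENNReal.ofReal (1 - p) * info (1 - p) =
      ENNReal.ofReal (Real.binEntropy p) := by
  have h1 : 0 ≤ 1 - p := by linarith [hp.2]
  rw [ofReal_mul_info hp.1, ofReal_mul_info h1,
    ← ENNReal.ofReal_add (Real.negMulLog_nonneg hp.1 hp.2)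
      (Real.negMulLog_nonneg h1 (by linarith [hp.1])),
    Real.binEntropy_eq_negMulLog_add_negMulLog_one_sub]

theorem MeasProp.measure_Ico_of_map_aff {ν' ν : Measure ℝ} {b c : ℝ} (hb : 0 < b)
    (h : MeasProp ν' (ν.map (aff b c))) :
    ∃ d : ℝ≥0∞, d ≠ 0 ∧ d ≠ ∞ ∧
      (∀ u v, ν' (Ico u v) = d * ν (Ico ((u - c) / b) ((v - c) / b))) ∧
      ∀ u v, ν' (Icc u v) = d * ν (Icc ((u - c) / b) ((v - c) / b)) := by
  obtain ⟨d, hd, rfl⟩ := h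
  refine ⟨d, by simpa using hd, ENNReal.coe_ne_top, fun u v => ?_, fun u v => ?_⟩
  · rw [Measure.smul_apply, Measure.map_apply (by fun_prop) measurableSet_Ico, ENNReal.smul_def,
      smul_eq_mul]
    congr 2; ext r
    simp only [mem_preimage, mem_Ico, aff, div_le_iff₀ hb, lt_div_iff₀ hb]
    constructor <;> rintro ⟨h1, h2⟩ <;> constructor <;> linarith
  · rw [Measure.smul_apply, Measure.map_apply (by fun_prop) measurableSet_Icc, ENNReal.smul_def,
      smul_eq_mul]
    congr 2; ext r
    simp only [mem_preimage, mem_Icc, aff, div_le_iff₀ hb, le_div_iff₀ hb]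
    constructor <;> rintro ⟨h1, h2⟩ <;> constructor <;> linarith

/-- Think of `ν` as the measure at `y = u(-s)x` and `ν'` as that at `x`. Moving the origin back from
`s`, the cells of levels `0` and `1` become `[0,1)` and its half containing `s`. -/
theorem cellMass_of_translate {ν' ν : Measure ℝ} {s : ℝ} (hs : s ∈ Ico (0 : ℝ) 1)
    (h : MeasProp ν' (ν.map (aff 1 (-s)))) (h0 : ν (Ico 0 1) ≠ 0) (ht : ν (Ico 0 1) ≠ ∞) :
    cellMass ν' 0 s ≠ 0 ∧ cellMass ν' 0 s ≠ ∞ ∧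
      cellMass ν' 1 s = ENNReal.ofReal (branchProb (halfProb ν) s) * cellMass ν' 0 s := by
  obtain ⟨d, hd0, hdt, hd, -⟩ := h.measure_Ico_of_map_aff one_pos
  have hf : Int.fract s = s := Int.fract_eq_self.2 hs
  have c0 : cellMass ν' 0 s = d * ν (Ico 0 1) := by
    rw [cellMass, hd]; simp [hf]
  refine ⟨c0 ▸ mul_ne_zero hd0 h0, c0 ▸ ENNReal.mul_ne_top hdt ht, ?_⟩
  rw [c0, cellMass, hd, pow_one]
  rcases lt_or_ge s (1 / 2) with h2 | h2
  · have e := doubling_of_lt hs.1 h2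
    rw [doubling] at e
    rw [e, branchProb, if_pos h2, ofReal_halfProb, mul_left_comm, ENNReal.div_mul_cancel h0 ht]
    congr 3 <;> ring
  · have e := doubling_of_le h2 hs.2
    rw [doubling] at e
    rw [e, branchProb, if_neg (not_lt.2 h2), ofReal_one_sub_halfProb h0 ht, mul_left_comm,
      ENNReal.div_mul_cancel h0 ht]
    congr 3 <;> ring

/-- Dilation by `2^n` carries level `n + k` about `s` to level `k` about `2^n s mod 1`; the factor
`d` is the same for all `k`, so it cancels in ratios. -/
theorem cellMass_of_scale {ν' ν : Measure ℝ} {n : ℕ} (h : MeasProp ν' (ν.map (aff (2 ^ n) 0)))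
    (s : ℝ) : ∃ d : ℝ≥0∞, d ≠ 0 ∧ d ≠ ∞ ∧
      ∀ k, cellMass ν' k (Int.fract ((2 : ℝ) ^ n * s)) = d * cellMass ν (n + k) s := by
  obtain ⟨d, hd0, hdt, hd, -⟩ := h.measure_Ico_of_map_aff (by positivity)
  refine ⟨d, hd0, hdt, fun k => ?_⟩
  have e : (2 : ℝ) ^ k * (2 ^ n * s) = 2 ^ (n + k) * s := by rw [pow_add]; ring
  rw [cellMass, hd, cellMass, fract_two_pow_mul_fract, e, sub_zero, sub_zero, div_div, div_div,
    ← pow_add, add_comm k n]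

/-- Telescoping of the information along the dyadic intervals containing a point. -/
theorem sum_info_eq_log_cellMass {ν : Measure ℝ} {s : ℝ} {r : ℕ → ℝ}
    (hr : ∀ n, r n ∈ Icc (0 : ℝ) 1) (hri : ∀ n, info (r n) ≠ ∞)
    (h0 : ∀ n, cellMass ν n s ≠ 0) (ht : ∀ n, cellMass ν n s ≠ ∞)
    (h : ∀ n, cellMass ν (n + 1) s = ENNReal.ofReal (r n) * cellMass ν n s) (n : ℕ) :
    Real.log (cellMass ν n s).toReal ≤ Real.log (cellMass ν 0 s).toReal ∧
    ∑ k ∈ Finset.range n, info (r k) = ENNReal.ofReal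
      (Real.log (cellMass ν 0 s).toReal - Real.log (cellMass ν n s).toReal) := by
  have step : ∀ n, 0 ≤ -Real.log (r n) ∧ info (r n) = ENNReal.ofReal (-Real.log (r n)) ∧
      Real.log (cellMass ν (n + 1) s).toReal =
        Real.log (r n) + Real.log (cellMass ν n s).toReal := by
    intro n
    -- Information is `∞` at probability zero, so finiteness makes the logarithms genuine.
    have hr0 : r n ≠ 0 := fun h0 => hri n (by simp [info, h0])
    refine ⟨?_, if_neg hr0, ?_⟩
    · linarith [Real.log_nonpos (hr n).1 (hr n).2]
    · rw [h n, ENNReal.toReal_mul, ENNReal.toReal_ofReal (hr n).1,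
        Real.log_mul hr0 (ENNReal.toReal_ne_zero.2 ⟨h0 n, ht n⟩)]
  induction n with
  | zero => simp
  | succ n ih =>
    obtain ⟨h1, h2, h3⟩ := step n
    refine ⟨by linarith [ih.1], ?_⟩
    rw [Finset.sum_range_succ, ih.2, h2, ← ENNReal.ofReal_add (by linarith [ih.1]) h1, h3]
    congr 1; ring

end Cells

/-! ### The skew product of the flow with the doubling map -/

section SkewProduct

variable {X : Type*} [TopologicalSpace X] [SecondCountableTopology X] [MeasurableSpace X]
  [BorelSpace X] [MulAction BGroup X] [ContinuousSMul BGroup X]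
  (μ : Measure X) [IsProbabilityMeasure μ]

instance : IsProbabilityMeasure ((volume : Measure ℝ).restrict (Ico 0 1)) :=
  ⟨by simp⟩

theorem lintegral_shearMeasure_Ico {g : X × ℝ → ℝ≥0∞} (hg : Measurable g) :
    ∫⁻ q, (((Ico (0 : ℝ) 1).indicator (1 : ℝ → ℝ≥0) q.2 : ℝ≥0) : ℝ≥0∞) * g q ∂(shearMeasure μ) =
      ∫⁻ z, g (uB (-z.2) • z.1, z.2) ∂(μ.prod ((volume : Measure ℝ).restrict (Ico 0 1))) := by
  have hI := measurable_indicator_Ico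
  rw [lintegral_shearMeasure μ (by fun_prop), lintegral_prod _ (by fun_prop)]
  refine lintegral_congr fun x => ?_
  exact lintegral_indicator_Ico_mul _ fun s => g (uB (-s) • x, s)

/-- The product of the geodesic flow at time `log 2` with the doubling map. -/
noncomputable def skewDoubling (z : X × ℝ) : X × ℝ := (aB (Real.log 2) • z.1, doubling z.2)

theorem measurePreserving_skewDoubling [SMulInvariantMeasure aSubgroup X μ] :
    MeasurePreserving skewDoubling (μ.prod ((volume : Measure ℝ).restrict (Ico 0 1)))
      (μ.prod ((volume : Measure ℝ).restrict (Ico 0 1))) :=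
  (measurePreserving_aB_smul μ (Real.log 2)).prod measurePreserving_doubling

theorem iterate_skewDoubling (x : X) {s : ℝ} (hs : s ∈ Ico (0 : ℝ) 1) (n : ℕ) :
    skewDoubling^[n] (x, s) = (aB (n * Real.log 2) • x, Int.fract ((2 : ℝ) ^ n * s)) := by
  rw [← iterate_doubling hs]
  induction n with
  | zero => simp
  | succ n ih =>
    rw [Function.iterate_succ_apply', ih, Function.iterate_succ_apply', skewDoubling]
    simp only [aB_smul_aB_smul]
    congr 3
    push_cast; ring

theorem ae_mem_Ico : ∀ᵐ z ∂(μ.prod ((volume : Measure ℝ).restrict (Ico 0 1))),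
    z.2 ∈ Ico (0 : ℝ) 1 :=
  Measure.quasiMeasurePreserving_snd.ae (ae_restrict_mem measurableSet_Ico)

theorem ae_prod_of_ae_antiConv {Q : X → Prop}
    (h : ∀ᵐ y ∂(antiConv ((Ico (0 : ℝ) 1).indicator 1) μ), Q y) :
    ∀ᵐ z ∂(μ.prod ((volume : Measure ℝ).restrict (Ico 0 1))), Q (uB (-z.2) • z.1) := by
  obtain ⟨S, hQS, hS, hS0⟩ := exists_measurable_superset_of_null (ae_iff.1 h)
  have hi : Measurable (S.indicator (1 : X → ℝ≥0∞)) := measurable_one.indicator hS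
  rw [← lintegral_indicator_one hS, lintegral_antiConv μ measurable_indicator_Ico hi,
    lintegral_shearMeasure_Ico μ (g := fun q => S.indicator 1 q.1) (by fun_prop),
    lintegral_eq_zero_iff (by fun_prop)] at hS0
  filter_upwards [hS0] with z hz
  by_contra hc
  have hm : uB (-z.2) • z.1 ∈ S := hQS hc
  simp [hm] at hz

end SkewProduct

/-! ### Digit information and its telescoping sums -/

namespace IsLeafwiseSystem

variable {X : Type*} [TopologicalSpace X] [SecondCountableTopology X] [MeasurableSpace X]
  [BorelSpace X] [MulAction BGroup X] [ContinuousSMul BGroup X]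
  {μ : Measure X} [IsProbabilityMeasure μ] {σ : X → Measure ℝ}

theorem lintegral_indicator_Ico_eq_one :
    ∫⁻ s, (((Ico (0 : ℝ) 1).indicator (1 : ℝ → ℝ≥0) s : ℝ≥0) : ℝ≥0∞) = 1 := by
  rw [lintegral_indicator_Ico]; simp

theorem mass_Ico (hσ : IsLeafwiseSystem μ σ) :
    ∀ᵐ y ∂(antiConv ((Ico (0 : ℝ) 1).indicator 1) μ),
      σ y (Ico 0 1) ≠ 0 ∧ σ y (Ico 0 1) ≠ ∞ := by
  filter_upwards [hσ.mass _ measurable_indicator_Ico lintegral_indicator_Ico_eq_one] with y hy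
  rw [lintegral_indicator_Ico] at hy
  exact ⟨hy.1.ne', hy.2.ne⟩

/-- Integration over the two halves of the unit interval in terms of `halfProb`. -/
theorem lintegral_branch (hσ : IsLeafwiseSystem μ σ) {a b : X → ℝ≥0∞} (ha : Measurable a)
    (hb : Measurable b) :
    ∫⁻ z, (if z.2 < 1 / 2 then a (uB (-z.2) • z.1) else b (uB (-z.2) • z.1))
        ∂(μ.prod ((volume : Measure ℝ).restrict (Ico 0 1))) =
      ∫⁻ y, (ENNReal.ofReal (halfProb (σ y)) * a y + ENNReal.ofReal (1 - halfProb (σ y)) * b y)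
        ∂(antiConv ((Ico (0 : ℝ) 1).indicator 1) μ) := by
  have hg : Measurable fun q : X × ℝ => if q.2 < 1 / 2 then a q.1 else b q.1 :=
    Measurable.ite (measurableSet_lt measurable_snd measurable_const)
      (ha.comp measurable_fst) (hb.comp measurable_fst)
  rw [← lintegral_shearMeasure_Ico μ hg,
    hσ.disintegration _ measurable_indicator_Ico lintegral_indicator_Ico_eq_one _ hg]
  refine lintegral_congr_ae ?_
  filter_upwards [hσ.mass_Ico] with y hy
  simp only [mul_comm _ ((ENNReal.ofNNReal _))]
  rw [lintegral_indicator_Ico_mul, lintegral_indicator_Ico,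
    inv_mul_setLIntegral_branch hy.1 hy.2]

/-- The information gained in the first dyadic digit of `z.2`. -/
noncomputable def digitInfo (σ : X → Measure ℝ) (z : X × ℝ) : ℝ≥0∞ :=
  info (branchProb (halfProb (σ (uB (-z.2) • z.1))) z.2)

theorem measurable_digitInfo (hσ : IsLeafwiseSystem μ σ) : Measurable (digitInfo σ) :=
  measurable_info.comp (measurable_branchProb.comp
    ((measurable_halfProb.comp (hσ.measurable.comp (by fun_prop))).prodMk measurable_snd))

/-- Given `y`, the digit takes its two values with probabilities `p` and `1 - p`, so its mean
information is the binary entropy. -/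
theorem lintegral_digitInfo (hσ : IsLeafwiseSystem μ σ) :
    ∫⁻ z, digitInfo σ z ∂(μ.prod ((volume : Measure ℝ).restrict (Ico 0 1))) =
      ∫⁻ y, ENNReal.ofReal (Real.binEntropy (halfProb (σ y)))
        ∂(antiConv ((Ico (0 : ℝ) 1).indicator 1) μ) := by
  have hm : Measurable fun y => halfProb (σ y) := measurable_halfProb.comp hσ.measurable
  have h := hσ.lintegral_branch (a := fun y => info (halfProb (σ y)))
    (b := fun y => info (1 - halfProb (σ y))) (measurable_info.comp hm)
    (measurable_info.comp (hm.const_sub 1))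
  simp only [ofReal_binEntropy (halfProb_mem_Icc _)] at h
  rw [← h]
  refine lintegral_congr fun z => ?_
  rw [digitInfo, branchProb]
  split_ifs <;> rfl

theorem lintegral_digitInfo_ne_top (hσ : IsLeafwiseSystem μ σ) :
    ∫⁻ z, digitInfo σ z ∂(μ.prod ((volume : Measure ℝ).restrict (Ico 0 1))) ≠ ∞ := by
  rw [hσ.lintegral_digitInfo]
  have := isProbabilityMeasure_antiConv μ measurable_indicator_Ico lintegral_indicator_Ico_eq_one
  refine ne_top_of_le_ne_top (b := ENNReal.ofReal (Real.log 2)) ENNReal.ofReal_ne_top ?_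
  calc _ ≤ ∫⁻ _y, ENNReal.ofReal (Real.log 2)
        ∂(antiConv ((Ico (0 : ℝ) 1).indicator 1) μ) :=
          lintegral_mono fun y => ENNReal.ofReal_le_ofReal Real.binEntropy_le_log_two
    _ = _ := by simp

/-- The `n`-th term of the Birkhoff sum is minus the logarithm of the ratio of the cells of levels
`n + 1` and `n`: zoom in by `a(n log 2)`, then move the origin to the left end of the cell. -/
theorem ae_cellMass [SMulInvariantMeasure aSubgroup X μ] (hσ : IsLeafwiseSystem μ σ) :
    ∀ᵐ z ∂(μ.prod ((volume : Measure ℝ).restrict (Ico 0 1))), z.2 ∈ Ico (0 : ℝ) 1 ∧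
      (∀ n, cellMass (σ z.1) n z.2 ≠ 0 ∧ cellMass (σ z.1) n z.2 ≠ ∞) ∧
      ∀ n : ℕ, Real.log (cellMass (σ z.1) n z.2).toReal ≤
          Real.log (cellMass (σ z.1) 0 z.2).toReal ∧
        birkhoffSum skewDoubling (digitInfo σ) n z = ENNReal.ofReal
          (Real.log (cellMass (σ z.1) 0 z.2).toReal -
            Real.log (cellMass (σ z.1) n z.2).toReal) := by
  have hT := measurePreserving_skewDoubling μ
  have h1 : ∀ᵐ z ∂(μ.prod ((volume : Measure ℝ).restrict (Ico 0 1))), ∀ n : ℕ,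
      σ (uB (-(skewDoubling^[n] z).2) • (skewDoubling^[n] z).1) (Ico 0 1) ≠ 0 ∧
      σ (uB (-(skewDoubling^[n] z).2) • (skewDoubling^[n] z).1) (Ico 0 1) ≠ ∞ :=
    ae_all_iff.2 fun n => (hT.iterate n).quasiMeasurePreserving.ae
      (ae_prod_of_ae_antiConv μ hσ.mass_Ico)
  have h2 : ∀ᵐ z ∂(μ.prod ((volume : Measure ℝ).restrict (Ico 0 1))), ∀ n : ℕ,
      MeasProp (σ (aB (n * Real.log 2) • z.1))
        ((σ z.1).map (aff (Real.exp (n * Real.log 2)) 0)) :=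
    ae_all_iff.2 fun n => Measure.quasiMeasurePreserving_fst.ae (hσ.aB_smul _)
  have h3 : ∀ᵐ z ∂(μ.prod ((volume : Measure ℝ).restrict (Ico 0 1))), ∀ n : ℕ,
      digitInfo σ (skewDoubling^[n] z) < ∞ :=
    ae_all_iff.2 fun n => (hT.iterate n).quasiMeasurePreserving.ae
      (ae_lt_top hσ.measurable_digitInfo hσ.lintegral_digitInfo_ne_top)
  filter_upwards [ae_mem_Ico μ, h1, h2, h3] with ⟨x, s⟩ hs e1 e2 e3
  simp only [iterate_skewDoubling x hs] at e1 e3 ⊢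
  dsimp only at hs e2 ⊢
  have hex : ∀ n : ℕ, Real.exp (n * Real.log 2) = 2 ^ n := fun n => by
    rw [Real.exp_nat_mul, Real.exp_log two_pos]
  simp only [hex] at e2
  have hsn : ∀ n : ℕ, Int.fract ((2 : ℝ) ^ n * s) ∈ Ico (0 : ℝ) 1 :=
    fun n => ⟨Int.fract_nonneg _, Int.fract_lt_one _⟩
  have key : ∀ n : ℕ, (cellMass (σ x) n s ≠ 0 ∧ cellMass (σ x) n s ≠ ∞) ∧
      cellMass (σ x) (n + 1) s = ENNReal.ofReal (branchProb (halfProb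
        (σ (uB (-Int.fract ((2 : ℝ) ^ n * s)) • aB (n * Real.log 2) • x)))
          (Int.fract ((2 : ℝ) ^ n * s))) * cellMass (σ x) n s := by
    intro n
    obtain ⟨d, hd0, hdt, hd⟩ := cellMass_of_scale (e2 n) s
    -- Equivariance is applied at `y = u(-s_n)a(n log 2)x` with `s_n = 2^n s mod 1`, so that
    -- `u(s_n)y` is `a(n log 2)x`.
    have hu := hσ.uB_smul (Int.fract ((2 : ℝ) ^ n * s))
      (uB (-Int.fract ((2 : ℝ) ^ n * s)) • aB (n * Real.log 2) • x)
    rw [uB_smul_uB_smul, add_neg_cancel, uB_zero_smul] at hu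
    obtain ⟨f0, ft, f1⟩ := cellMass_of_translate (hsn n) hu (e1 n).1 (e1 n).2
    rw [hd] at f0 ft
    rw [hd, hd, mul_left_comm] at f1
    exact ⟨⟨right_ne_zero_of_mul f0, fun h => ft (by rw [add_zero, h, ENNReal.mul_top hd0])⟩,
      (ENNReal.mul_right_inj hd0 hdt).1 f1⟩
  refine ⟨hs, fun n => (key n).1, fun n => ?_⟩
  have := sum_info_eq_log_cellMass (ν := σ x) (s := s)
    (fun n => branchProb_mem_Icc (halfProb_mem_Icc
      (σ (uB (-Int.fract ((2 : ℝ) ^ n * s)) • aB (n * Real.log 2) • x)))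
        (Int.fract ((2 : ℝ) ^ n * s)))
    (fun n => (e3 n).ne) (fun n => (key n).1.1) (fun n => (key n).1.2) (fun n => (key n).2) n
  refine ⟨this.1, ?_⟩
  rw [← this.2, birkhoffSum]
  refine Finset.sum_congr rfl fun k _ => ?_
  rw [iterate_skewDoubling x hs, digitInfo]

end IsLeafwiseSystem

/-! ### From dyadic cells to symmetric intervals -/

section LocalDimension

/-- Minus the logarithm of the mass of the interval of radius `e^{-t}` about zero. -/
noncomputable def logDecay (ν : Measure ℝ) (t : ℝ) : ℝ :=
  -Real.log (ν (Icc (-Real.exp (-t)) (Real.exp (-t)))).toReal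

/-- `ν` charges every neighbourhood of zero and has local dimension `δ` there. -/
def HasDimAtZero (ν : Measure ℝ) (δ : ℝ) : Prop :=
  (∀ t : ℝ, 0 < ν (Icc (-Real.exp (-t)) (Real.exp (-t)))) ∧
    Tendsto (fun t => logDecay ν t / t) atTop (𝓝 δ)

theorem exp_neg_mul_log_two (n : ℕ) (ε : ℝ) :
    Real.exp (-(n * (Real.log 2 + ε))) = Real.exp (-(n * ε)) / 2 ^ n := by
  have : Real.exp (n * Real.log 2) = 2 ^ n := by rw [Real.exp_nat_mul, Real.exp_log two_pos]
  rw [← this, ← Real.exp_sub]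
  congr 1; ring

/-- The cell contains `0` and has length `2^{-n}`, so it lies in the interval of radius `2^{-n}`.
Eventually it contains the interval of radius `2^{-n}e^{-nε}`, because neither end point is
exponentially close on its own scale. Monotonicity and `ε → 0` finish. -/
theorem hasDimAtZero_of_cellMass {ν : Measure ℝ} [IsLocallyFiniteMeasure ν] {s γ : ℝ}
    (hc : ∀ n, cellMass ν n s ≠ 0)
    (hγ : Tendsto (fun n : ℕ => -Real.log (cellMass ν n s).toReal / n) atTop (𝓝 γ))
    (hε : ∀ j : ℕ, ∀ᶠ n : ℕ in atTop,
      Real.exp (-(n * (1 / ((j : ℝ) + 1)))) ≤ Int.fract ((2 : ℝ) ^ n * s) ∧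
        Real.exp (-(n * (1 / ((j : ℝ) + 1)))) < 1 - Int.fract ((2 : ℝ) ^ n * s)) :
    HasDimAtZero ν (γ / Real.log 2) := by
  have hfin : ∀ t : ℝ, ν (Icc (-Real.exp (-t)) (Real.exp (-t))) ≠ ∞ :=
    fun t => isCompact_Icc.measure_lt_top.ne
  have hsub : ∀ n : ℕ, cellMass ν n s ≤
      ν (Icc (-Real.exp (-(n * Real.log 2))) (Real.exp (-(n * Real.log 2)))) := by
    intro n
    have e := exp_neg_mul_log_two n 0
    rw [add_zero, mul_zero, neg_zero, Real.exp_zero] at e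
    rw [e]
    refine measure_mono fun r hr => ⟨le_trans ?_ hr.1, hr.2.le.trans ?_⟩
    · rw [← neg_div]
      gcongr
      exact (Int.fract_lt_one _).le
    · gcongr
      linarith [Int.fract_nonneg ((2 : ℝ) ^ n * s)]
  have hl2 : 0 < Real.log 2 := Real.log_pos one_lt_two
  have hpos : ∀ t : ℝ, 0 < ν (Icc (-Real.exp (-t)) (Real.exp (-t))) := by
    intro t
    obtain ⟨n, hn⟩ := exists_nat_ge (t / Real.log 2)
    rw [div_le_iff₀ hl2] at hn
    have he : Real.exp (-(n * Real.log 2)) ≤ Real.exp (-t) := Real.exp_le_exp.2 (by linarith)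
    exact (pos_iff_ne_zero.2 (hc n)).trans_le ((hsub n).trans
      (measure_mono (Icc_subset_Icc (neg_le_neg he) he)))
  have hcfin : ∀ n, cellMass ν n s ≠ ∞ := fun n => ne_top_of_le_ne_top (hfin _) (hsub n)
  refine ⟨hpos, ?_⟩
  refine Monotone.tendsto_div_of_squeeze ?_ hl2 hγ ?_ ?_
  · intro a b hab
    have he : Real.exp (-b) ≤ Real.exp (-a) := Real.exp_le_exp.2 (by linarith)
    refine neg_le_neg (Real.log_le_log (ENNReal.toReal_pos (hpos b).ne' (hfin b)) ?_)
    exact ENNReal.toReal_mono (hfin a) (measure_mono (Icc_subset_Icc (neg_le_neg he) he))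
  · intro n
    exact neg_le_neg (Real.log_le_log (ENNReal.toReal_pos (hc n) (hcfin n))
      (ENNReal.toReal_mono (hfin _) (hsub n)))
  · intro j
    filter_upwards [hε j] with n hn
    refine neg_le_neg (Real.log_le_log (ENNReal.toReal_pos (hpos _).ne' (hfin _))
      (ENNReal.toReal_mono (hcfin n) (measure_mono ?_)))
    rw [exp_neg_mul_log_two]
    intro r hr
    refine ⟨le_trans ?_ hr.1, hr.2.trans_lt ?_⟩
    · rw [← neg_div]
      gcongr
      exact hn.1
    · gcongr
      exact hn.2

/-- Dilation by `e^t` shifts the argument of `logDecay` by `t` and adds a constant; neither affects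
the linear rate. -/
theorem HasDimAtZero.of_scale {ν ν' : Measure ℝ} {δ t : ℝ} (hν : HasDimAtZero ν δ)
    (hfin : ∀ t : ℝ, ν (Icc (-Real.exp (-t)) (Real.exp (-t))) ≠ ∞)
    (h : MeasProp ν' (ν.map (aff (Real.exp t) 0))) : HasDimAtZero ν' δ := by
  obtain ⟨d, hd0, hdt, -, hd⟩ := h.measure_Ico_of_map_aff (Real.exp_pos t)
  have key : ∀ τ : ℝ, ν' (Icc (-Real.exp (-τ)) (Real.exp (-τ))) =
      d * ν (Icc (-Real.exp (-(τ + t))) (Real.exp (-(τ + t)))) := by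
    intro τ
    have e : Real.exp (-(τ + t)) = Real.exp (-τ) / Real.exp t := by
      rw [← Real.exp_sub]; congr 1; ring
    rw [hd, e, sub_zero, sub_zero, neg_div]
  refine ⟨fun τ => ?_, ?_⟩
  · rw [key]
    exact pos_iff_ne_zero.2 (mul_ne_zero hd0 (hν.1 _).ne')
  · have h1 : ∀ τ, logDecay ν' τ = logDecay ν (τ + t) - Real.log d.toReal := by
      intro τ
      rw [logDecay, key, ENNReal.toReal_mul, Real.log_mul (ENNReal.toReal_ne_zero.2 ⟨hd0, hdt⟩)
        (ENNReal.toReal_ne_zero.2 ⟨(hν.1 _).ne', hfin _⟩), logDecay]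
      ring
    have h2 : Tendsto (fun τ : ℝ => logDecay ν (τ + t) / (τ + t)) atTop (𝓝 δ) :=
      hν.2.comp (tendsto_atTop_add_const_right _ t tendsto_id)
    have h3 : Tendsto (fun τ : ℝ => 1 + t / τ) atTop (𝓝 (1 + 0)) :=
      tendsto_const_nhds.add (tendsto_const_nhds.div_atTop tendsto_id)
    have h4 : Tendsto (fun τ : ℝ => Real.log d.toReal / τ) atTop (𝓝 0) :=
      tendsto_const_nhds.div_atTop tendsto_id
    have h5 := (h2.mul h3).sub h4
    rw [add_zero, mul_one, sub_zero] at h5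
    refine h5.congr' ?_
    filter_upwards [eventually_gt_atTop 0, eventually_gt_atTop (-t)] with τ h0 h0'
    have : τ + t ≠ 0 := by linarith
    rw [h1]
    field_simp

end LocalDimension

/-! ### Constancy of the dimension, its value, and stationarity -/

namespace IsLeafwiseSystem

variable {X : Type*} [TopologicalSpace X] [SecondCountableTopology X] [MeasurableSpace X]
  [BorelSpace X] [MulAction BGroup X] [ContinuousSMul BGroup X]
  {μ : Measure X} [IsProbabilityMeasure μ] {σ : X → Measure ℝ}

/-- The local dimension exists almost everywhere; it is the ergodic average of `digitInfo`. -/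
theorem ae_hasDimAtZero [SMulInvariantMeasure aSubgroup X μ] (hσ : IsLeafwiseSystem μ σ) :
    ∃ g : X × ℝ → ℝ≥0∞,
      (∀ᵐ z ∂(μ.prod ((volume : Measure ℝ).restrict (Ico 0 1))), g z ≠ ∞ ∧
        HasDimAtZero (σ z.1) ((g z).toReal / Real.log 2)) ∧
      ∫⁻ z, g z ∂(μ.prod ((volume : Measure ℝ).restrict (Ico 0 1))) =
        ∫⁻ y, ENNReal.ofReal (Real.binEntropy (halfProb (σ y)))
          ∂(antiConv ((Ico (0 : ℝ) 1).indicator 1) μ) := by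
  have hfin : ∫⁻ z, digitInfo σ z ∂(μ.prod ((volume : Measure ℝ).restrict (Ico 0 1))) ≠ ∞ :=
    hσ.lintegral_digitInfo_ne_top
  obtain ⟨g, -, hg, hgi⟩ := exists_tendsto_birkhoffSum_div (measurePreserving_skewDoubling μ)
    hσ.measurable_digitInfo hfin
  refine ⟨g, ?_, by rw [hgi, hσ.lintegral_digitInfo]⟩
  have hε : ∀ᵐ z ∂(μ.prod ((volume : Measure ℝ).restrict (Ico 0 1))), ∀ j : ℕ,
      ∀ᶠ n : ℕ in atTop,
      Real.exp (-(n * (1 / ((j : ℝ) + 1)))) ≤ Int.fract ((2 : ℝ) ^ n * z.2) ∧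
        Real.exp (-(n * (1 / ((j : ℝ) + 1)))) < 1 - Int.fract ((2 : ℝ) ^ n * z.2) :=
    ae_all_iff.2 fun j => Measure.quasiMeasurePreserving_snd.ae
      (ae_eventually_exp_le_fract (by positivity))
  filter_upwards [hg, hε, hσ.ae_cellMass] with z ⟨h1, h2⟩ h3 ⟨_, h5, h6⟩
  have := hσ.locallyFinite z.1
  refine ⟨h1, hasDimAtZero_of_cellMass (fun n => (h5 n).1) ?_ h3⟩
  have h7 := (ENNReal.tendsto_toReal h1).comp h2
  have h8 : Tendsto (fun n : ℕ => Real.log (cellMass (σ z.1) 0 z.2).toReal / n) atTop (𝓝 0) :=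
    tendsto_const_nhds.div_atTop tendsto_natCast_atTop_atTop
  have h9 := h7.sub h8
  rw [sub_zero] at h9
  refine h9.congr fun n => ?_
  simp only [Function.comp]
  rw [(h6 n).2, ENNReal.toReal_div, ENNReal.toReal_ofReal (by linarith [(h6 n).1]),
    ENNReal.toReal_natCast]
  ring

/-- The local dimension is flow invariant because `a(t)` only dilates `σ_x`. Ergodicity makes it
constant, and the integral of the Birkhoff limit fixes its value. -/
theorem hasDimAtZero_const [ErgodicSMul aSubgroup X μ] (hσ : IsLeafwiseSystem μ σ) :
    ∀ᵐ x ∂μ, HasDimAtZero (σ x) ((∫ y, Real.binEntropy (halfProb (σ y))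
      ∂(antiConv ((Ico (0 : ℝ) 1).indicator 1) μ)) / Real.log 2) := by
  obtain ⟨g, hg, hgi⟩ := hσ.ae_hasDimAtZero
  have hl2 : 0 < Real.log 2 := Real.log_pos one_lt_two
  have hex : ∀ᵐ x ∂μ, ∃ δ, HasDimAtZero (σ x) δ := by
    filter_upwards [Measure.ae_ae_of_ae_prod hg] with x hx
    obtain ⟨s, hs⟩ := hx.exists
    exact ⟨_, hs.2⟩
  -- Ergodicity needs a measurable dimension function; the limit along integers provides one.
  have hmeas : ∀ n : ℕ, AEMeasurable (fun x => logDecay (σ x) n / n) μ := fun n =>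
    ((((Measure.measurable_coe measurableSet_Icc).comp
      hσ.measurable).ennreal_toReal.log.neg).div_const _).aemeasurable
  obtain ⟨D, hDm, hD⟩ := measurable_limit_of_tendsto_metrizable_ae (L := atTop) hmeas
    (hex.mono fun x ⟨δ, hδ⟩ => ⟨δ, hδ.2.comp tendsto_natCast_atTop_atTop⟩)
  have hDdim : ∀ᵐ x ∂μ, HasDimAtZero (σ x) (D x) := by
    filter_upwards [hex, hD] with x ⟨δ, hδ⟩ hx
    rwa [tendsto_nhds_unique hx (hδ.2.comp tendsto_natCast_atTop_atTop)]
  have hinv : ∀ t : ℝ, ∀ᵐ x ∂μ, D (aB t • x) = D x := by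
    intro t
    filter_upwards [hDdim, (measurePreserving_aB_smul μ t).quasiMeasurePreserving.ae hDdim,
      hσ.aB_smul t] with x h1 h2 h3
    have := hσ.locallyFinite x
    exact tendsto_nhds_unique h2.2 (h1.of_scale (fun t => isCompact_Icc.measure_lt_top.ne) h3).2
  obtain ⟨c, hc⟩ : ∃ c, D =ᵐ[μ] Function.const X c := by
    refine exists_eventuallyEq_const_of_forall_separating MeasurableSet fun U hU => ?_
    have := aeconst_of_forall_preimage_smul_ae_eq (μ := μ) aSubgroup (s := D ⁻¹' U)
      (hDm hU).nullMeasurableSet fun a => ?_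
    · exact eventuallyConst_pred.1 this
    · obtain ⟨_, t, rfl⟩ := a
      refine (hinv t).mono fun x hx => ?_
      change (D (aB t • x) ∈ U) = (D x ∈ U)
      rw [hx]
  have hcdim : ∀ᵐ x ∂μ, HasDimAtZero (σ x) c := by
    filter_upwards [hDdim, hc] with x h1 h2
    rw [h2] at h1
    exact h1
  -- By uniqueness of limits the Birkhoff limit depends only on the dimension at the first
  -- coordinate, so it is constant too, although `T` was not shown to be ergodic.
  have hgc : ∀ᵐ z ∂(μ.prod ((volume : Measure ℝ).restrict (Ico 0 1))),
      g z = ENNReal.ofReal (c * Real.log 2) := by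
    filter_upwards [hg, Measure.quasiMeasurePreserving_fst.ae hcdim] with z h1 h2
    rw [← tendsto_nhds_unique h1.2.2 h2.2, div_mul_cancel₀ _ hl2.ne', ENNReal.ofReal_toReal h1.1]
  have hc0 : 0 ≤ c * Real.log 2 := by
    obtain ⟨z, h1, h2⟩ := (hg.and (Measure.quasiMeasurePreserving_fst.ae hcdim)).exists
    rw [← tendsto_nhds_unique h1.2.2 h2.2, div_mul_cancel₀ _ hl2.ne']
    exact ENNReal.toReal_nonneg
  have hint : ∫ y, Real.binEntropy (halfProb (σ y)) ∂(antiConv ((Ico (0 : ℝ) 1).indicator 1) μ) =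
      c * Real.log 2 := by
    rw [integral_eq_lintegral_of_nonneg_ae (Eventually.of_forall fun y =>
      Real.binEntropy_nonneg (halfProb_mem_Icc _).1 (halfProb_mem_Icc _).2)
      (Real.binEntropy_continuous.measurable.comp
        (measurable_halfProb.comp hσ.measurable)).aestronglyMeasurable, ← hgi,
      lintegral_congr_ae hgc]
    simp [hc0]
  rw [hint, mul_div_cancel_right₀ _ hl2.ne']
  exact hcdim

theorem integral_binEntropy_halfProb (hσ : IsLeafwiseSystem μ σ) :
    ∫ y, Real.binEntropy (halfProb (σ y)) ∂(antiConv ((Ico (0 : ℝ) 1).indicator 1) μ) =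
      ∫ y, Real.binEntropy (halfProb (condLeaf μ y))
        ∂(antiConv ((Ico (0 : ℝ) 1).indicator 1) μ) := by
  refine integral_congr_ae ?_
  filter_upwards [hσ.ae_antiConv_measProp measurable_indicator_Ico] with y hy
  rw [hy.halfProb_eq]

/-- The law of the base point is stationary for the chain with transition probabilities given by
the leafwise measures. -/
theorem bind_chainKernel [SMulInvariantMeasure aSubgroup X μ] (hσ : IsLeafwiseSystem μ σ) :
    (antiConv ((Ico (0 : ℝ) 1).indicator 1) μ).bind (chainKernel fun y => halfProb (σ y)) =
      antiConv ((Ico (0 : ℝ) 1).indicator 1) μ := by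
  have hp : Measurable fun y => halfProb (σ y) := measurable_halfProb.comp hσ.measurable
  have happ : ∀ E, MeasurableSet E → ∀ y, chainKernel (fun y => halfProb (σ y)) y E =
      ENNReal.ofReal (halfProb (σ y)) * E.indicator 1 (aB (Real.log 2) • y) +
      ENNReal.ofReal (1 - halfProb (σ y)) * E.indicator 1 (uB 1 • aB (Real.log 2) • y) := by
    intro E hE y
    simp [chainKernel, Measure.dirac_apply' _ hE]
  have hk : Measurable (chainKernel fun y => halfProb (σ y)) := by
    refine Measure.measurable_of_measurable_coe _ fun E hE => ?_
    have hi : Measurable (E.indicator (1 : X → ℝ≥0∞)) := measurable_one.indicator hE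
    simp_rw [happ E hE]
    fun_prop
  ext E hE
  have hi : Measurable (E.indicator (1 : X → ℝ≥0∞)) := measurable_one.indicator hE
  rw [Measure.bind_apply hE hk.aemeasurable]
  simp_rw [happ E hE]
  rw [← hσ.lintegral_branch (a := fun y => E.indicator 1 (aB (Real.log 2) • y))
    (b := fun y => E.indicator 1 (uB 1 • aB (Real.log 2) • y)) (by fun_prop) (by fun_prop),
    ← lintegral_indicator_one hE, lintegral_antiConv μ measurable_indicator_Ico hi,
    lintegral_shearMeasure_Ico μ (g := fun q => E.indicator 1 q.1) (by fun_prop),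
    ← (measurePreserving_skewDoubling μ).lintegral_comp
      (f := fun z => E.indicator 1 (uB (-z.2) • z.1)) (by fun_prop)]
  refine lintegral_congr_ae ?_
  filter_upwards [ae_mem_Ico μ] with z hz
  have he : Real.exp (Real.log 2) = 2 := Real.exp_log two_pos
  -- With `y = u(-s)x`, one has `a(log 2)y = u(-2s)a(log 2)x`; when the second digit value occurs,
  -- `u(1)` restores the `1` that the doubling map removes.
  simp only [skewDoubling, aB_smul_uB_smul, he]
  split_ifs with h2
  · rw [doubling_of_lt hz.1 h2, mul_neg]
  · rw [doubling_of_le (not_lt.1 h2) hz.2, uB_smul_uB_smul,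
      show 1 + 2 * -z.2 = -(2 * z.2 - 1) by ring]

end IsLeafwiseSystem

theorem lemma3p6 {X : Type*} [TopologicalSpace X] [T2Space X] [LocallyCompactSpace X]
    [SecondCountableTopology X] [MeasurableSpace X] [BorelSpace X]
    [MulAction BGroup X] [ContinuousSMul BGroup X]
    (μ : Measure X) [IsProbabilityMeasure μ] [ErgodicSMul aSubgroup X μ] (hfree : IsUFree μ) :
    ∃ δ : ℝ, HasLeafwiseDim μ δ ∧
      ∃ p : X → ℝ, Measurable p ∧ (∀ x, p x ∈ Icc (0 : ℝ) 1) ∧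
        ∫ x, Real.binEntropy (p x) ∂(antiConv ((Ico (0 : ℝ) 1).indicator 1) μ) =
          δ * Real.log 2 ∧
        (antiConv ((Ico (0 : ℝ) 1).indicator 1) μ).bind (chainKernel p) =
          antiConv ((Ico (0 : ℝ) 1).indicator 1) μ := by
  have hσ := isLeafwiseSystem_leaf μ
  refine ⟨(∫ y, Real.binEntropy (halfProb (leaf μ y))
      ∂(antiConv ((Ico (0 : ℝ) 1).indicator 1) μ)) / Real.log 2,
    ⟨⟨leaf μ, hσ⟩, fun τ hτ => ?_⟩, fun y => halfProb (leaf μ y),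
    measurable_halfProb.comp hσ.measurable, fun y => halfProb_mem_Icc _, ?_, hσ.bind_chainKernel⟩
  -- An arbitrary system `τ` is compared with `leaf μ` through `condLeaf`: both give the same
  -- entropy integral, hence the same `δ`.
  · rw [hσ.integral_binEntropy_halfProb, ← hτ.integral_binEntropy_halfProb]
    filter_upwards [hτ.hasDimAtZero_const] with x hx
    refine ⟨hx.1, hx.2.neg.congr fun t => ?_⟩
    rw [logDecay]; ring
  · rw [div_mul_cancel₀ _ (Real.log_pos one_lt_two).ne']
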